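/- Let $G$ be a finite group. A set $X$ of conjugacy classes of $G$ *invariably generates* $G$ if, whenever one element is chosen from each class in $X$, the chosen elements generate $G$; $G$ is *invariably $2$-generated* if $\{C,D\}$ invariably generates $G$ for some conjugacy classes $C,D$ of $G$. Let $\Lambda(G)$ be the graph whose vertices are the conjugacy classes of $G$ other than $\{1\}$, two distinct vertices $C,D$ being adjacent if $\{C,D\}$ invariably generates $G$, and let $\Lambda^+(G)$ be the graph obtained from $\Lambda(G)$ by removing its isolated vertices. For a group $S$, let $\beta(S)$ be the largest integer $t\ge 0$ such that the direct power $S^t$ is invariably $2$-generated (when it exists), and let $N(S)$ be the number of connected components of $\Lambda^+(S^{\beta(S)})$. **Theorem.** Let $q$ range over the prime powers with $q\ge 4$, and let $S=\mathrm{PSL}_2(q)$. Then $\beta(S)$ exists for every such $q$, and: 1. There is a function $\varepsilon_1(q)\to 0$ as $q\to\infty$ such that $\beta(S)\ge q^{2-\varepsilon_1(q)}$ for all sufficiently large $q$; and there is a constant $K$ such that $\beta(S)\le \frac{q^2}{2}+Kq$ for all $q$. 2. There is a function $\varepsilon_2(q)\to 0$ as $q\to\infty$ such that $N(S)\ge 2^{\,q^{2-\varepsilon_2(q)}}$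 for all sufficiently large $q$. -/

import Mathlib

open Filter Topology
open scoped MatrixGroups

universe u

/-- A set `X` of conjugacy classes of `G` invariably generates `G` if, for every choice of one
element from each class in `X`, the chosen elements generate `G`. -/
def InvariablyGenerates {G : Type u} [Group G] (X : Set (ConjClasses G)) : Prop :=
  ∀ x : ConjClasses G → G, (∀ C ∈ X, x C ∈ C.carrier) → Subgroup.closure (x '' X) = ⊤

/-- `G` is invariably `2`-generated if some conjugacy classes `C`, `D` invariably generate it. -/
def IsInvariablyTwoGenerated (G : Type u) [Group G] : Prop :=
  ∃ C D : ConjClasses G, InvariablyGenerates {C, D}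

/-- The invariably generating graph `Λ(G)`: the vertices are the conjugacy classes other than
`{1}`, and two distinct vertices are adjacent if together they invariably generate `G`. -/
def invGenGraph (G : Type u) [Group G] :
    SimpleGraph {C : ConjClasses G // C ≠ ConjClasses.mk 1} where
  Adj C D := C ≠ D ∧ InvariablyGenerates {C.1, D.1}
  symm := ⟨fun C D h => ⟨h.1.symm, by rw [Set.pair_comm]; exact h.2⟩⟩
  loopless := ⟨fun _ h => h.1 rfl⟩

/-- `Λ⁺(G)`: the graph `Λ(G)` with its isolated vertices removed
(the support of a graph is the set of vertices that have a neighbour). -/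
def invGenGraphPlus (G : Type u) [Group G] : SimpleGraph (invGenGraph G).support :=
  (invGenGraph G).induce (invGenGraph G).support

/-- The set of `t` such that the direct power `S ^ t` is invariably `2`-generated. -/
def invTwoGenPowers (S : Type u) [Group S] : Set ℕ :=
  {t | IsInvariablyTwoGenerated (Fin t → S)}

/-- `β(S)`: the largest `t` such that `S ^ t` is invariably `2`-generated
(meaningful when the set of such `t` has a largest element). -/
noncomputable def invBeta (S : Type u) [Group S] : ℕ :=
  sSup (invTwoGenPowers S)

/-- `N(S)`: the number of connected components of `Λ⁺(S ^ β)`, where `β = β(S)`. -/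
noncomputable def numComponents (S : Type u) [Group S] : ℕ :=
  Nat.card (invGenGraphPlus (Fin (invBeta S) → S)).ConnectedComponent

/-! For a nonabelian finite simple group `G`, a Goursat argument shows that a pair of classes of
`G^t` invariably generates exactly when each coordinate pair invariably generates `G` and no
automorphism of `G` carries one coordinate pair to another (`invGen_pi_iff`). So `β(G)` is the
number of `Aut G`-orbits on ordered invariably generating pairs (`invBeta_eq`), and the task is to
count orbits for `PSL₂(q)`.

Call a class nonsplit if `X² - tX + 1` has no root, `t` being the trace up to sign. Two split
classes both meet the Borel subgroup, and two nonsplit classes both meet one nonsplit torus, so an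
invariably generating pair has exactly one nonsplit class (`InvGen.isNonsplitClass_iff`). With at
most `q + 3` classes in all, AM-GM bounds the number of ordered pairs by `(q + 3)² / 2`, which is
the upper bound.

For the lower bound, take the class of a diagonal matrix whose entry generates `Fˣ`, and any class
of nonzero nonsplit trace. They invariably generate, because a subgroup containing the whole
diagonal torus together with an element of nonzero trace and nonzero off-diagonal entries is
everything (`eq_top_of_diag_mem`). There are about `φ(q - 1) · q / 2` such pairs. Automorphisms act
on traces through field endomorphisms up to sign (`exists_ringHom_tr`), so an orbit contains only
`O(log q)` of them, and `φ(n) ≥ n / (log₂ n + 1)`.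

For the components, every edge of the graph exchanges split and nonsplit in all coordinates at once,
so the type vector modulo global complement is constant on components. At `t = β(S)` the coordinates
run over all orbits, which the swap of the two classes matches in pairs. Reversing any subset of the
`β/2` swap-pairs gives another edge, and hence at least `2^(β/2) / 2` components. -/

namespace SL2

/-! ### Explicit matrices, entries and traces in `SL₂` -/

variable {F : Type u} [Field F]

/-- The trace of an element of `SL₂`. -/
def tr (A : SL(2, F)) : F := A 0 0 + A 1 1

/-- The upper unitriangular matrix with entry `x`. -/
def upper (x : F) : SL(2, F) := ⟨!![1, x; 0, 1], by simp [Matrix.det_fin_two]⟩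

/-- The lower unitriangular matrix with entry `x`. -/
def lower (x : F) : SL(2, F) := ⟨!![1, 0; x, 1], by simp [Matrix.det_fin_two]⟩

/-- The diagonal matrix with entries `s`, `s⁻¹`. -/
def diag (s : Fˣ) : SL(2, F) := ⟨!![(s : F), 0; 0, ((s⁻¹ : Fˣ) : F)], by simp [Matrix.det_fin_two]⟩

/-- The companion matrix of `X² - tX + 1`. -/
def comp (t : F) : SL(2, F) := ⟨!![0, -1; 1, t], by simp [Matrix.det_fin_two]⟩

@[simp] lemma upper_00 (x : F) : upper x 0 0 = 1 := rfl
@[simp] lemma upper_01 (x : F) : upper x 0 1 = x := rfl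
@[simp] lemma upper_10 (x : F) : upper x 1 0 = 0 := rfl
@[simp] lemma upper_11 (x : F) : upper x 1 1 = 1 := rfl
@[simp] lemma lower_00 (x : F) : lower x 0 0 = 1 := rfl
@[simp] lemma lower_01 (x : F) : lower x 0 1 = 0 := rfl
@[simp] lemma lower_10 (x : F) : lower x 1 0 = x := rfl
@[simp] lemma lower_11 (x : F) : lower x 1 1 = 1 := rfl
@[simp] lemma diag_00 (s : Fˣ) : diag s 0 0 = s := rfl
@[simp] lemma diag_01 (s : Fˣ) : diag s 0 1 = 0 := rfl
@[simp] lemma diag_10 (s : Fˣ) : diag s 1 0 = 0 := rfl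
@[simp] lemma diag_11 (s : Fˣ) : diag s 1 1 = (s : F)⁻¹ := by simp [diag]
@[simp] lemma comp_00 (t : F) : comp t 0 0 = 0 := rfl
@[simp] lemma comp_01 (t : F) : comp t 0 1 = -1 := rfl
@[simp] lemma comp_10 (t : F) : comp t 1 0 = 1 := rfl
@[simp] lemma comp_11 (t : F) : comp t 1 1 = t := rfl

@[simp] lemma mul_entry (A B : SL(2, F)) (i j : Fin 2) :
    (A * B) i j = A i 0 * B 0 j + A i 1 * B 1 j := by
  simp [Matrix.mul_apply, Fin.sum_univ_two]

@[simp] lemma inv_00 (A : SL(2, F)) : A⁻¹ 0 0 = A 1 1 := by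
  simp [Matrix.adjugate_fin_two]
@[simp] lemma inv_01 (A : SL(2, F)) : A⁻¹ 0 1 = -A 0 1 := by
  simp [Matrix.adjugate_fin_two]
@[simp] lemma inv_10 (A : SL(2, F)) : A⁻¹ 1 0 = -A 1 0 := by
  simp [Matrix.adjugate_fin_two]
@[simp] lemma inv_11 (A : SL(2, F)) : A⁻¹ 1 1 = A 0 0 := by
  simp [Matrix.adjugate_fin_two]
@[simp] lemma neg_entry (A : SL(2, F)) (i j : Fin 2) : (-A) i j = -A i j := by
  simp
lemma det_eq (A : SL(2, F)) : A 0 0 * A 1 1 - A 0 1 * A 1 0 = 1 := by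
  rw [← Matrix.det_fin_two]; exact A.2

lemma ext4 {A B : SL(2, F)} (h00 : A 0 0 = B 0 0) (h01 : A 0 1 = B 0 1)
    (h10 : A 1 0 = B 1 0) (h11 : A 1 1 = B 1 1) : A = B := by
  ext i j; fin_cases i <;> fin_cases j <;> assumption

lemma one_00 : (1 : SL(2, F)) 0 0 = 1 := by simp
lemma one_10 : (1 : SL(2, F)) 1 0 = 0 := by simp
lemma one_11 : (1 : SL(2, F)) 1 1 = 1 := by simp

@[simp] lemma tr_neg (A : SL(2, F)) : tr (-A) = -tr A := by
  simp [tr]; ring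

@[simp] lemma tr_comp (t : F) : tr (comp t) = t := by simp [tr]

@[simp] lemma tr_diag (s : Fˣ) : tr (diag s) = s + (s : F)⁻¹ := by simp [tr]

lemma tr_conj (A P : SL(2, F)) : tr (P * A * P⁻¹) = tr A := by
  have := det_eq P
  simp only [tr, mul_entry, inv_00, inv_01, inv_10, inv_11]
  linear_combination (A 0 0 + A 1 1) * this

lemma tr_eq_of_isConj {A B : SL(2, F)} (h : IsConj A B) : tr A = tr B := by
  obtain ⟨P, rfl⟩ := isConj_iff.1 h
  exact (tr_conj A P).symm

lemma upper_add (x y : F) : upper (x + y) = upper x * upper y := by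
  apply ext4 <;> simp [add_comm]

lemma lower_add (x y : F) : lower (x + y) = lower x * lower y := by
  apply ext4 <;> simp

@[simp] lemma upper_zero : upper (0 : F) = 1 := by
  apply ext4 <;> simp

lemma upper_inv (x : F) : (upper x)⁻¹ = upper (-x) := by
  apply ext4 <;> simp

lemma diag_conj_upper (s : Fˣ) (x : F) :
    diag s * upper x * (diag s)⁻¹ = upper ((s : F) ^ 2 * x) := by
  apply ext4 <;> simp; ring

lemma comp_eq (t : F) : comp t = comp 0 * upper t := by
  apply ext4 <;> simp

/-! ### The projective group -/

lemma mk_eq_iff {A B : SL(2, F)} : (A : PSL(2, F)) = (B : PSL(2, F)) ↔ A = B ∨ A = -B := by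
  rw [QuotientGroup.eq, Matrix.SpecialLinearGroup.mem_center_iff]
  constructor
  · rintro ⟨r, hr, h⟩
    have hB : B = A * (A⁻¹ * B) := by group
    have e : ∀ i j, B i j = A i j * r := by
      intro i j
      rw [hB, mul_entry, ← h]
      fin_cases j <;> simp
    simp only [Fintype.card_fin] at hr
    rcases (show r = 1 ∨ r = -1 from by simpa using hr) with rfl | rfl
    · left; ext i j; rw [e i j, mul_one]
    · right; ext i j; rw [neg_entry, e i j]; ring
  · rintro (rfl | rfl)
    · exact ⟨1, by simp, by simp⟩
    · exact ⟨-1, by simp, by ext i j; fin_cases i <;> fin_cases j <;> simp⟩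

lemma mk_neg (A : SL(2, F)) : ((-A : SL(2, F)) : PSL(2, F)) = A := by
  rw [mk_eq_iff]; right; rfl

lemma isConj_mk {A B : SL(2, F)} (h : IsConj A B) : IsConj (A : PSL(2, F)) (B : PSL(2, F)) :=
  (QuotientGroup.mk' (Subgroup.center SL(2, F))).map_isConj h

lemma isConj_mk_iff {A B : SL(2, F)} :
    IsConj (A : PSL(2, F)) (B : PSL(2, F)) ↔ IsConj A B ∨ IsConj A (-B) := by
  constructor
  · intro h
    obtain ⟨P, hP⟩ := isConj_iff.1 h
    obtain ⟨P, rfl⟩ := QuotientGroup.mk_surjective P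
    rw [← QuotientGroup.mk_inv, ← QuotientGroup.mk_mul, ← QuotientGroup.mk_mul, mk_eq_iff] at hP
    exact hP.imp (fun h => isConj_iff.2 ⟨P, h⟩) (fun h => isConj_iff.2 ⟨P, h⟩)
  · rintro (h | h)
    · exact isConj_mk h
    · simpa [mk_neg] using isConj_mk h

/-! ### Conjugacy classes and traces -/

/-- The form is `det(v, Av)` for `v = (x, y)`. When it equals `1`, the basis `(v, Av)` has
determinant one, and in it `A` is its companion matrix. -/
lemma isConj_comp_of_form {A : SL(2, F)} {x y : F}
    (h : A 1 0 * x ^ 2 + (A 1 1 - A 0 0) * x * y - A 0 1 * y ^ 2 = 1) :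
    IsConj (comp (tr A)) A := by
  let P : SL(2, F) := ⟨!![x, A 0 0 * x + A 0 1 * y; y, A 1 0 * x + A 1 1 * y], by
    rw [Matrix.det_fin_two_of]; linear_combination h⟩
  refine isConj_iff.2 ⟨P, ?_⟩
  rw [mul_inv_eq_iff_eq_mul]
  have d := det_eq A
  have e00 : P 0 0 = x := rfl
  have e01 : P 0 1 = A 0 0 * x + A 0 1 * y := rfl
  have e10 : P 1 0 = y := rfl
  have e11 : P 1 1 = A 1 0 * x + A 1 1 * y := rfl
  apply ext4 <;> simp only [mul_entry, e00, e01, e10, e11, comp_00, comp_01, comp_10, comp_11, tr]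
  · ring
  · linear_combination x * d
  · ring
  · linear_combination y * d

open Polynomial in
lemma exists_quadratic_eq_one [Finite F] (h2 : ringChar F ≠ 2) {c e : F} (hc : c ≠ 0) (he : e ≠ 0) :
    ∃ x y : F, c * x ^ 2 + e * y ^ 2 = 1 := by
  have := Fintype.ofFinite F
  obtain ⟨x, y, h⟩ := FiniteField.exists_root_sum_quadratic (R := F)
    (f := C c * X ^ 2 + C 0 * X + C (-1)) (g := C e * X ^ 2 + C 0 * X + C 0)
    (degree_quadratic hc) (degree_quadratic he) (FiniteField.odd_card_of_char_ne_two h2)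
  refine ⟨x, y, ?_⟩
  simp at h
  linear_combination h

/-- The form `det(v, Av)` has discriminant `tr² - 4`, which is nonzero here, and a nondegenerate
binary form over a finite field represents `1`. Hence the trace determines the class away from `±2`.
-/
lemma isConj_comp [Finite F] {A : SL(2, F)} (h1 : tr A ≠ 2) (h2 : tr A ≠ -2) : IsConj (comp (tr A)) A := by
  have d := det_eq A
  have hdisc : (A 1 1 - A 0 0) ^ 2 + 4 * A 0 1 * A 1 0 ≠ 0 := by
    have : (A 1 1 - A 0 0) ^ 2 + 4 * A 0 1 * A 1 0 = (tr A - 2) * (tr A - -2) := by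
      simp only [tr]; linear_combination 4 * (-d)
    rw [this]
    exact mul_ne_zero (sub_ne_zero.2 h1) (sub_ne_zero.2 h2)
  by_cases hc : A 1 0 = 0
  · have hda : A 1 1 - A 0 0 ≠ 0 := by
      intro h; apply hdisc; rw [h, hc]; ring
    apply isConj_comp_of_form (x := (1 + A 0 1) / (A 1 1 - A 0 0)) (y := 1)
    rw [hc]; field_simp; ring
  by_cases hchar : ringChar F = 2
  · obtain ⟨x, hx⟩ := FiniteField.isSquare_of_char_two hchar (A 1 0)⁻¹
    apply isConj_comp_of_form (x := x) (y := 0)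
    rw [pow_two, ← hx]; field_simp; ring
  · have h20 : (2 : F) ≠ 0 := Ring.two_ne_zero hchar
    have h40 : (4 : F) ≠ 0 := by
      have : (4 : F) = 2 * 2 := by norm_num
      rw [this]; exact mul_ne_zero h20 h20
    obtain ⟨x, y, h⟩ := exists_quadratic_eq_one hchar hc
      -- This is the second coefficient left after completing the square in `x`.
      (e := -((A 1 1 - A 0 0) ^ 2 + 4 * A 0 1 * A 1 0) / (4 * A 1 0))
      (div_ne_zero (neg_ne_zero.2 hdisc) (mul_ne_zero h40 hc))
    apply isConj_comp_of_form (x := x - (A 1 1 - A 0 0) / (2 * A 1 0) * y) (y := y)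
    refine Eq.trans ?_ h
    field_simp; ring

/-- A matrix whose characteristic polynomial has a root is conjugate to a triangular one. -/
lemma exists_conj_triangular {A : SL(2, F)} {l : F} (hl : l ^ 2 - tr A * l + 1 = 0) :
    ∃ P : SL(2, F), (P * A * P⁻¹) 1 0 = 0 := by
  have d := det_eq A
  by_cases hc : A 1 0 = 0
  · exact ⟨1, by simpa using hc⟩
  · refine ⟨(⟨!![(l - A 1 1) / A 1 0, -1; 1, 0], by simp [Matrix.det_fin_two]⟩ : SL(2, F))⁻¹, ?_⟩
    set P : SL(2, F) := ⟨!![(l - A 1 1) / A 1 0, -1; 1, 0], by simp [Matrix.det_fin_two]⟩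
    have e00 : P 0 0 = (l - A 1 1) / A 1 0 := rfl
    have e01 : P 0 1 = -1 := rfl
    have e10 : P 1 0 = 1 := rfl
    have e11 : P 1 1 = 0 := rfl
    rw [inv_inv]
    simp only [mul_entry, e00, e10, inv_10, inv_11]
    field_simp
    simp only [tr] at hl
    linear_combination hl + d

/-- An element of trace `±2` is, up to sign, conjugate to a unitriangular one. -/
lemma exists_conj_upper {A : SL(2, F)} (h : tr A = 2 ∨ tr A = -2) :
    ∃ x : F, IsConj (upper x : PSL(2, F)) A := by
  wlog h2 : tr A = 2 generalizing A
  · have h3 := h.resolve_left h2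
    obtain ⟨x, hx⟩ := this (A := -A) (Or.inl (by rw [tr_neg, h3, neg_neg]))
      (by rw [tr_neg, h3, neg_neg])
    exact ⟨x, by rwa [mk_neg] at hx⟩
  obtain ⟨P, hP⟩ := exists_conj_triangular (A := A) (l := 1) (by rw [h2]; ring)
  set B := P * A * P⁻¹ with hB
  have hAB : IsConj A B := isConj_iff.2 ⟨P, rfl⟩
  have ht : tr B = 2 := by rw [← tr_eq_of_isConj hAB, h2]
  have d := det_eq B
  have h0 : B 0 0 = 1 := by
    have : (B 0 0 - 1) ^ 2 = 0 := by
      simp only [tr] at ht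
      linear_combination B 0 0 * ht - d - B 0 1 * hP
    exact sub_eq_zero.1 (pow_eq_zero_iff (two_ne_zero)|>.1 this)
  have h1 : B 1 1 = 1 := by simp only [tr] at ht; linear_combination ht - h0
  refine ⟨B 0 1, ?_⟩
  have : upper (B 0 1) = B := by
    apply ext4 <;> simp [h0, h1, hP]
  rw [this]
  exact (isConj_mk hAB).symm

end SL2

/-! ### Invariable generation of powers of a simple group -/

section InvariableGeneration

variable {G : Type u} [Group G]

/-- Every choice of representatives of the classes `C` and `D` generates the group. -/
def InvGen (C D : ConjClasses G) : Prop :=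
  ∀ x y : G, ConjClasses.mk x = C → ConjClasses.mk y = D → Subgroup.closure {x, y} = ⊤

lemma InvGen.symm {C D : ConjClasses G} (h : InvGen C D) : InvGen D C := fun x y hx hy => by
  rw [Set.pair_comm]; exact h y x hy hx

lemma invariablyGenerates_pair_iff {C D : ConjClasses G} :
    InvariablyGenerates {C, D} ↔ InvGen C D := by
  classical
  constructor
  · intro h x y hx hy
    -- When the classes coincide, a choice function supplies a single element, which must then
    -- generate alone; adding a second representative changes nothing.
    by_cases hCD : C = D
    · have := h (fun E => if E = C then x else Quot.out E) (by
        intro E hE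
        have hE' : E = C := by simpa [← hCD] using hE
        simp [hE', ConjClasses.mem_carrier_iff_mk_eq, hx])
      rw [eq_top_iff, ← this]
      apply Subgroup.closure_mono
      rintro _ ⟨E, hE, rfl⟩
      have hE' : E = C := by simpa [← hCD] using hE
      simp [hE']
    · have := h (fun E => if E = C then x else y) (by
        rintro E (rfl | rfl)
        · simp [ConjClasses.mem_carrier_iff_mk_eq, hx]
        · simp [ConjClasses.mem_carrier_iff_mk_eq, hy, Ne.symm hCD])
      rw [← this, Set.image_pair]
      simp [Ne.symm hCD]
  · intro h x hx
    rw [Set.image_pair]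
    exact h _ _ (ConjClasses.mem_carrier_iff_mk_eq.1 (hx C (by simp)))
      (ConjClasses.mem_carrier_iff_mk_eq.1 (hx D (by simp)))

lemma not_commute_of_closure_pair_eq_top (hcomm : ∃ a b : G, a * b ≠ b * a) {x y : G}
    (h : Subgroup.closure {x, y} = ⊤) : x * y ≠ y * x := by
  intro hxy
  have hc : ∀ a ∈ ({x, y} : Set G), ∀ b ∈ ({x, y} : Set G), a * b = b * a := by
    rintro _ (rfl | rfl) _ (rfl | rfl)
    · rfl
    · exact hxy
    · exact hxy.symm
    · rfl
  obtain ⟨a, b, hab⟩ := hcomm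
  have := Subgroup.isMulCommutative_closure hc
  exact hab (congrArg Subtype.val (mul_comm' (⟨a, by rw [h]; trivial⟩ : Subgroup.closure _)
    (⟨b, by rw [h]; trivial⟩ : Subgroup.closure _)))

lemma InvGen.ne_one (hcomm : ∃ a b : G, a * b ≠ b * a) {C D : ConjClasses G} (h : InvGen C D) :
    C ≠ ConjClasses.mk 1 := by
  rintro rfl
  obtain ⟨y, rfl⟩ := ConjClasses.exists_rep D
  exact not_commute_of_closure_pair_eq_top hcomm (h 1 y rfl rfl) (by simp)

lemma InvGen.ne (hcomm : ∃ a b : G, a * b ≠ b * a) {C D : ConjClasses G} (h : InvGen C D) :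
    C ≠ D := by
  rintro rfl
  obtain ⟨y, rfl⟩ := ConjClasses.exists_rep C
  exact not_commute_of_closure_pair_eq_top hcomm (h y y rfl rfl) rfl

lemma isConj_pi_iff {ι : Type*} {x y : ι → G} : IsConj x y ↔ ∀ i, IsConj (x i) (y i) := by
  simp only [isConj_iff]
  constructor
  · rintro ⟨c, rfl⟩ i
    exact ⟨c i, rfl⟩
  · intro h
    choose c hc using h
    exact ⟨c, funext hc⟩

lemma mk_update {ι : Type*} [DecidableEq ι] {x : ι → G} {i : ι} {a : G}
    (h : ConjClasses.mk a = ConjClasses.mk (x i)) :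
    ConjClasses.mk (Function.update x i a) = ConjClasses.mk x := by
  rw [ConjClasses.mk_eq_mk_iff_isConj] at h ⊢
  rw [isConj_pi_iff]
  intro j
  by_cases hj : j = i
  · subst hj; simpa using h
  · rw [Function.update_of_ne hj]

lemma exists_mulEquiv_of_ker_eq {H : Type*} [Group H] {f g : H →* G} (hf : Function.Surjective f)
    (hg : Function.Surjective g) (h : f.ker = g.ker) : ∃ α : G ≃* G, ∀ x, g x = α (f x) := by
  refine ⟨(QuotientGroup.quotientKerEquivOfSurjective f hf).symm.trans
    ((QuotientGroup.quotientMulEquivOfEq h).trans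
      (QuotientGroup.quotientKerEquivOfSurjective g hg)), fun x => ?_⟩
  have : (QuotientGroup.quotientKerEquivOfSurjective f hf).symm (f x) = (x : H ⧸ f.ker) := by
    rw [MulEquiv.symm_apply_eq]; rfl
  simp only [MulEquiv.trans_apply, this]
  rfl

variable {ι : Type*}

/-- The values at `i` of the elements of `H` that are trivial on `J`. -/
def valuesTrivialOn (H : Subgroup (ι → G)) (i : ι) (J : Set ι) : Subgroup G where
  carrier := {s | ∃ h ∈ H, h i = s ∧ ∀ j ∈ J, h j = 1}
  one_mem' := ⟨1, H.one_mem, by simp⟩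
  mul_mem' := by
    rintro _ _ ⟨h, hh, rfl, h1⟩ ⟨k, hk, rfl, k1⟩
    exact ⟨h * k, H.mul_mem hh hk, rfl, fun j hj => by simp [h1 j hj, k1 j hj]⟩
  inv_mem' := by
    rintro _ ⟨h, hh, rfl, h1⟩
    exact ⟨h⁻¹, H.inv_mem hh, rfl, fun j hj => by simp [h1 j hj]⟩

lemma valuesTrivialOn_normal {H : Subgroup (ι → G)} (hsurj : ∀ i s, ∃ h ∈ H, h i = s) (i : ι)
    (J : Set ι) : (valuesTrivialOn H i J).Normal := by
  constructor
  rintro _ ⟨h, hh, rfl, h1⟩ s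
  obtain ⟨k, hk, rfl⟩ := hsurj i s
  exact ⟨k * h * k⁻¹, H.mul_mem (H.mul_mem hk hh) (H.inv_mem hk), rfl,
    fun j hj => by simp [h1 j hj]⟩

/-- Goursat's lemma for two coordinates. By simplicity each of the two normal subgroups of values is
trivial or everything; if both are trivial, the two projections have the same kernel and `H` lies
over the graph of an automorphism. -/
lemma valuesTrivialOn_singleton [IsSimpleGroup G] {H : Subgroup (ι → G)}
    (hsurj : ∀ i s, ∃ h ∈ H, h i = s) {i j : ι}
    (hα : ∀ α : G ≃* G, ∃ h ∈ H, h j ≠ α (h i)) : valuesTrivialOn H i {j} = ⊤ := by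
  rcases (valuesTrivialOn_normal hsurj i {j}).eq_bot_or_eq_top with hi | hi
  swap
  · exact hi
  exfalso
  have hij : ∀ h ∈ H, h j = 1 → h i = 1 := fun h hh hj => by
    have : h i ∈ valuesTrivialOn H i {j} := ⟨h, hh, rfl, by simpa using hj⟩
    rwa [hi, Subgroup.mem_bot] at this
  rcases (valuesTrivialOn_normal hsurj j {i}).eq_bot_or_eq_top with hj | hj
  · have hji : ∀ h ∈ H, h i = 1 → h j = 1 := fun h hh hi => by
      have : h j ∈ valuesTrivialOn H j {i} := ⟨h, hh, rfl, by simpa using hi⟩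
      rwa [hj, Subgroup.mem_bot] at this
    obtain ⟨α, h⟩ := exists_mulEquiv_of_ker_eq
      (f := (Pi.evalMonoidHom (fun _ : ι => G) i).comp H.subtype)
      (g := (Pi.evalMonoidHom (fun _ : ι => G) j).comp H.subtype)
      (fun s => by obtain ⟨h, hh, rfl⟩ := hsurj i s; exact ⟨⟨h, hh⟩, rfl⟩)
      (fun s => by obtain ⟨h, hh, rfl⟩ := hsurj j s; exact ⟨⟨h, hh⟩, rfl⟩)
      (by
        ext ⟨h, hh⟩
        exact ⟨hji h hh, hij h hh⟩)
    obtain ⟨k, hk, hne⟩ := hα α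
    exact hne (h ⟨k, hk⟩)
  -- In the mixed case, correct an element nontrivial at `i` by one that is trivial at `i` and has
  -- the same value at `j`; the quotient is trivial at `j` but not at `i`.
  · obtain ⟨s, hs⟩ := exists_ne (1 : G)
    obtain ⟨h, hh, rfl⟩ := hsurj i s
    obtain ⟨k, hk, hkj, hki⟩ : h j ∈ valuesTrivialOn H j {i} := by rw [hj]; trivial
    have := hij (h * k⁻¹) (H.mul_mem hh (H.inv_mem hk)) (by simp [hkj])
    apply hs
    simpa [hki i rfl] using this

/-- A commutator of an element trivial on `J` with one trivial at `k` is trivial on both sets. Its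
value at `i` can be any commutator of `G`, so the normal subgroup of values is not trivial. -/
lemma valuesTrivialOn_finset [IsSimpleGroup G] (hcomm : ∃ a b : G, a * b ≠ b * a)
    {H : Subgroup (ι → G)} (hsurj : ∀ i s, ∃ h ∈ H, h i = s)
    (hα : ∀ i j, i ≠ j → ∀ α : G ≃* G, ∃ h ∈ H, h j ≠ α (h i)) (i : ι) (J : Finset ι)
    (hiJ : i ∉ J) : valuesTrivialOn H i J = ⊤ := by
  classical
  induction J using Finset.induction_on with
  | empty =>
    rw [eq_top_iff]
    intro s _
    obtain ⟨h, hh, rfl⟩ := hsurj i s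
    exact ⟨h, hh, rfl, by simp⟩
  | insert k J _ ih =>
    simp only [Finset.mem_insert, not_or] at hiJ
    have ih := ih hiJ.2
    have hk := valuesTrivialOn_singleton hsurj (hα i k hiJ.1)
    rcases (valuesTrivialOn_normal hsurj i ((insert k J : Finset ι) : Set ι)).eq_bot_or_eq_top
      with h | h
    swap
    · exact h
    exfalso
    obtain ⟨a, b, hab⟩ := hcomm
    obtain ⟨x, hx, hxa, hx1⟩ : a ∈ valuesTrivialOn H i J := by rw [ih]; trivial
    obtain ⟨y, hy, hyb, hy1⟩ : b ∈ valuesTrivialOn H i {k} := by rw [hk]; trivial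
    have hm : a * b * a⁻¹ * b⁻¹ ∈ valuesTrivialOn H i ((insert k J : Finset ι) : Set ι) := by
      refine ⟨x * y * x⁻¹ * y⁻¹, H.mul_mem (H.mul_mem (H.mul_mem hx hy) (H.inv_mem hx))
        (H.inv_mem hy), by simp [hxa, hyb], fun j hj => ?_⟩
      rcases Finset.mem_insert.1 (Finset.mem_coe.1 hj) with rfl | hj
      · simp [hy1 j rfl]
      · simp [hx1 j hj]
    rw [h, Subgroup.mem_bot, mul_inv_eq_one, mul_inv_eq_iff_eq_mul] at hm
    exact hab hm

/-- A subgroup of a finite power of a nonabelian simple group which projects onto every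
coordinate and lies in no graph of an automorphism is the whole power. -/
lemma eq_top_of_no_diagonal [Finite ι] [IsSimpleGroup G] (hcomm : ∃ a b : G, a * b ≠ b * a)
    {H : Subgroup (ι → G)} (hsurj : ∀ i s, ∃ h ∈ H, h i = s)
    (hα : ∀ i j, i ≠ j → ∀ α : G ≃* G, ∃ h ∈ H, h j ≠ α (h i)) : H = ⊤ := by
  classical
  have := Fintype.ofFinite ι
  rw [eq_top_iff]
  intro x _
  apply Subgroup.pi_mem_of_mulSingle_mem
  intro i
  obtain ⟨h, hh, hi, h1⟩ : x i ∈ valuesTrivialOn H i ((Finset.univ.erase i : Finset ι) : Set ι) := by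
    rw [valuesTrivialOn_finset hcomm hsurj hα i _ (by simp)]; trivial
  convert hh using 1
  funext j
  by_cases hj : j = i
  · subst hj; simp [hi]
  · rw [Pi.mulSingle_eq_of_ne hj, h1 j (by simpa using hj)]

lemma map_mk_mulEquiv (α : G ≃* G) (x : G) :
    (ConjClasses.mk x).map α.toMonoidHom = ConjClasses.mk (α x) := rfl

lemma ConjClasses.map_mulEquiv_symm (α : G ≃* G) (C : ConjClasses G) :
    (C.map α.toMonoidHom).map α.symm.toMonoidHom = C := by
  obtain ⟨x, rfl⟩ := ConjClasses.exists_rep C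
  rw [map_mk_mulEquiv, map_mk_mulEquiv, MulEquiv.symm_apply_apply]

/-- This reduces powers to `G` itself: the coordinate pairs must generate and lie in distinct `Aut
G`-orbits, which by `eq_top_of_no_diagonal` is also enough. -/
lemma invGen_pi_iff [Finite ι] [IsSimpleGroup G] (hcomm : ∃ a b : G, a * b ≠ b * a)
    (x y : ι → G) : InvGen (ConjClasses.mk x) (ConjClasses.mk y) ↔
      (∀ i, InvGen (ConjClasses.mk (x i)) (ConjClasses.mk (y i))) ∧
      ∀ i j (α : G ≃* G), ConjClasses.mk (α (x i)) = ConjClasses.mk (x j) →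
        ConjClasses.mk (α (y i)) = ConjClasses.mk (y j) → i = j := by
  classical
  constructor
  · intro h
    constructor
    · intro i a b ha hb
      have key := h (Function.update x i a) (Function.update y i b)
        (mk_update ha) (mk_update hb)
      have := congrArg (Subgroup.map (Pi.evalMonoidHom (fun _ : ι => G) i)) key
      rw [MonoidHom.map_closure, Set.image_pair] at this
      simp only [Pi.evalMonoidHom_apply, Function.update_self] at this
      rw [this, ← MonoidHom.range_eq_map, MonoidHom.range_eq_top]
      exact Function.surjective_eval i
    · intro i j α hx hy
      by_contra hij
      have key := h (Function.update x j (α (x i))) (Function.update y j (α (y i)))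
        (mk_update hx) (mk_update hy)
      -- Representatives at `j` can be chosen as the `α`-images of those at `i`, so the chosen
      -- elements stay in the proper subgroup lying over the graph of `α`.
      let K : Subgroup (ι → G) := (Pi.evalMonoidHom (fun _ : ι => G) j).eqLocus
        (α.toMonoidHom.comp (Pi.evalMonoidHom (fun _ : ι => G) i))
      have hK : Subgroup.closure {Function.update x j (α (x i)), Function.update y j (α (y i))} ≤ K := by
        rw [Subgroup.closure_le]
        rintro z (rfl | rfl)
        · change Function.update x j (α (x i)) j = α (Function.update x j (α (x i)) i)
          simp [Function.update_of_ne hij]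
        · change Function.update y j (α (y i)) j = α (Function.update y j (α (y i)) i)
          simp [Function.update_of_ne hij]
      rw [key] at hK
      obtain ⟨s, hs⟩ := exists_ne (1 : G)
      have : Pi.mulSingle j s ∈ K := hK trivial
      change (Pi.mulSingle j s : ι → G) j = α ((Pi.mulSingle j s : ι → G) i) at this
      simp [Pi.mulSingle_eq_of_ne hij, hs] at this
  · rintro ⟨h1, h2⟩ a b ha hb
    rw [ConjClasses.mk_eq_mk_iff_isConj, isConj_pi_iff] at ha hb
    simp only [← ConjClasses.mk_eq_mk_iff_isConj] at ha hb
    apply eq_top_of_no_diagonal hcomm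
    · intro i s
      have key := h1 i (a i) (b i) (ha i) (hb i)
      have := MonoidHom.map_closure (Pi.evalMonoidHom (fun _ : ι => G) i) {a, b}
      rw [Set.image_pair] at this
      simp only [Pi.evalMonoidHom_apply, key] at this
      have hs : s ∈ (⊤ : Subgroup G) := trivial
      rw [← this] at hs
      exact hs
    · intro i j hij α
      by_contra! hc
      refine hij (h2 i j α ?_ ?_)
      · rw [← ha j, hc a (Subgroup.subset_closure (by simp)), ← map_mk_mulEquiv, ← map_mk_mulEquiv,
          ha i]
      · rw [← hb j, hc b (Subgroup.subset_closure (by simp)), ← map_mk_mulEquiv, ← map_mk_mulEquiv,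
          hb i]

variable (G) in
/-- The ordered pairs of classes which invariably generate `G`. -/
def InvGenPair : Type u := {p : ConjClasses G × ConjClasses G // InvGen p.1 p.2}

variable (G) in
/-- Two invariably generating pairs are equivalent if an automorphism maps one to the other. -/
def invGenSetoid : Setoid (InvGenPair G) where
  r p q := ∃ α : G ≃* G, p.1.1.map α.toMonoidHom = q.1.1 ∧ p.1.2.map α.toMonoidHom = q.1.2
  iseqv := by
    refine ⟨fun p => ⟨MulEquiv.refl G, ?_, ?_⟩, ?_, ?_⟩
    · obtain ⟨x, hx⟩ := ConjClasses.exists_rep p.1.1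
      rw [← hx]; rfl
    · obtain ⟨x, hx⟩ := ConjClasses.exists_rep p.1.2
      rw [← hx]; rfl
    · rintro p q ⟨α, h1, h2⟩
      exact ⟨α.symm, by rw [← h1, ConjClasses.map_mulEquiv_symm],
        by rw [← h2, ConjClasses.map_mulEquiv_symm]⟩
    · rintro p q r ⟨α, h1, h2⟩ ⟨γ, h3, h4⟩
      refine ⟨α.trans γ, ?_, ?_⟩
      · rw [← h3, ← h1]
        obtain ⟨x, hx⟩ := ConjClasses.exists_rep p.1.1
        rw [← hx]; rfl
      · rw [← h4, ← h2]
        obtain ⟨x, hx⟩ := ConjClasses.exists_rep p.1.2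
        rw [← hx]; rfl

variable (G) in
/-- The orbits of the automorphism group on invariably generating pairs. -/
def InvGenOrbit : Type u := Quotient (invGenSetoid G)

/-- The orbit of an invariably generating pair. -/
def InvGenPair.orbit (p : InvGenPair G) : InvGenOrbit G := Quotient.mk (invGenSetoid G) p

lemma InvGenPair.orbit_eq_iff {p q : InvGenPair G} : p.orbit = q.orbit ↔
    ∃ α : G ≃* G, p.1.1.map α.toMonoidHom = q.1.1 ∧ p.1.2.map α.toMonoidHom = q.1.2 :=
  ⟨fun h => Quotient.exact h, fun h => Quotient.sound h⟩

lemma InvGenPair.exists_orbit (o : InvGenOrbit G) : ∃ p : InvGenPair G, p.orbit = o :=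
  Quotient.exists_rep o

instance [Finite G] : Finite (ConjClasses G) := Quotient.finite _

instance [Finite G] : Finite (InvGenPair G) := Subtype.finite

instance [Finite G] : Finite (InvGenOrbit G) := Quotient.finite _

/-- A family of inequivalent invariably generating pairs gives an invariably generating pair of
the corresponding power. -/
lemma invGen_pi_of_injective [Finite ι] [IsSimpleGroup G] (hcomm : ∃ a b : G, a * b ≠ b * a)
    (x y : ι → G) (h : ∀ i, InvGen (ConjClasses.mk (x i)) (ConjClasses.mk (y i)))
    (hinj : Function.Injective (fun i =>
      InvGenPair.orbit ⟨(ConjClasses.mk (x i), ConjClasses.mk (y i)), h i⟩)) :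
    InvGen (ConjClasses.mk x) (ConjClasses.mk y) :=
  (invGen_pi_iff hcomm x y).2 ⟨h, fun _ _ α hx hy => hinj (InvGenPair.orbit_eq_iff.2 ⟨α, hx, hy⟩)⟩

lemma isInvariablyTwoGenerated_pi_iff [Finite G] [IsSimpleGroup G]
    (hcomm : ∃ a b : G, a * b ≠ b * a) (t : ℕ) :
    IsInvariablyTwoGenerated (Fin t → G) ↔ t ≤ Nat.card (InvGenOrbit G) := by
  simp only [IsInvariablyTwoGenerated, invariablyGenerates_pair_iff]
  constructor
  · rintro ⟨C, D, h⟩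
    obtain ⟨x, rfl⟩ := ConjClasses.exists_rep C
    obtain ⟨y, rfl⟩ := ConjClasses.exists_rep D
    obtain ⟨h1, h2⟩ := (invGen_pi_iff hcomm x y).1 h
    have := Nat.card_le_card_of_injective (fun i : Fin t =>
      InvGenPair.orbit ⟨(ConjClasses.mk (x i), ConjClasses.mk (y i)), h1 i⟩) (by
          intro i j hij
          obtain ⟨α, ha, hb⟩ := InvGenPair.orbit_eq_iff.1 hij
          exact h2 i j α ha hb)
    rwa [Nat.card_fin] at this
  · intro h
    let e := (Finite.equivFin (InvGenOrbit G)).symm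
    let f : Fin t → InvGenOrbit G := fun i => e (Fin.castLE h i)
    have hf : Function.Injective f := e.injective.comp (Fin.castLE_injective h)
    choose p hp using fun i => InvGenPair.exists_orbit (f i)
    choose x hx using fun i => ConjClasses.exists_rep (p i).1.1
    choose y hy using fun i => ConjClasses.exists_rep (p i).1.2
    have hg : ∀ i, InvGen (ConjClasses.mk (x i)) (ConjClasses.mk (y i)) := fun i => by
      rw [hx, hy]; exact (p i).2
    refine ⟨_, _, invGen_pi_of_injective hcomm x y hg ?_⟩
    convert hf using 1
    funext i
    rw [← hp i]
    congr 1
    exact Subtype.ext (Prod.ext (hx i) (hy i))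

lemma invTwoGenPowers_eq [Finite G] [IsSimpleGroup G] (hcomm : ∃ a b : G, a * b ≠ b * a) :
    invTwoGenPowers G = Set.Iic (Nat.card (InvGenOrbit G)) :=
  Set.ext fun t => isInvariablyTwoGenerated_pi_iff hcomm t

lemma invBeta_eq [Finite G] [IsSimpleGroup G] (hcomm : ∃ a b : G, a * b ≠ b * a) :
    invBeta G = Nat.card (InvGenOrbit G) := by
  rw [invBeta, invTwoGenPowers_eq hcomm, csSup_Iic]

end InvariableGeneration

namespace SL2

/-! ### A generation criterion -/

variable {F : Type u} [Field F]

/-- The squares have index at most two in `Fˣ`. -/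
lemma isSquare_mul_of_iff [Finite F] {a b : F} (ha : a ≠ 0) (hb : b ≠ 0)
    (h : IsSquare a ↔ IsSquare b) : IsSquare (a * b) := by
  have := Fintype.ofFinite F
  by_cases hF : ringChar F = 2
  · exact FiniteField.isSquare_of_char_two hF _
  · by_cases hs : IsSquare a
    · exact hs.mul (h.1 hs)
    · have hs' := fun hb => hs (h.2 hb)
      rw [FiniteField.isSquare_iff hF ha] at hs
      rw [FiniteField.isSquare_iff hF hb] at hs'
      rw [FiniteField.isSquare_iff hF (mul_ne_zero ha hb), mul_pow,
        (FiniteField.pow_dichotomy hF ha).resolve_left hs,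
        (FiniteField.pow_dichotomy hF hb).resolve_left hs']
      ring

lemma exists_sq_sub_sq [Finite F] (m : F) : ∃ a b : F, m = a ^ 2 - b ^ 2 := by
  by_cases hF : ringChar F = 2
  · obtain ⟨a, ha⟩ := FiniteField.isSquare_of_char_two hF m
    exact ⟨a, 0, by rw [ha]; ring⟩
  · have h2 : (2 : F) ≠ 0 := Ring.two_ne_zero hF
    exact ⟨(m + 1) / 2, (m - 1) / 2, by field_simp; ring⟩

lemma exists_unit_sq_ne_one [Finite F] (hq : 4 ≤ Nat.card F) : ∃ s : Fˣ, (s : F) ^ 2 ≠ 1 := by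
  classical
  have := Fintype.ofFinite F
  by_contra! h
  have : (Finset.univ : Finset F) ⊆ {0, 1, -1} := by
    intro x _
    by_cases hx : x = 0
    · simp [hx]
    · have := h (Units.mk0 x hx)
      rw [Units.val_mk0, sq_eq_one_iff] at this
      rcases this with rfl | rfl <;> simp
  have := (Finset.card_le_card this).trans Finset.card_le_three
  rw [Finset.card_univ, ← Nat.card_eq_fintype_card] at this
  omega

/-- The double coset of `h` under the upper unitriangular group is determined by the lower left
entry, once that entry is nonzero. -/
lemma mem_of_upper_mem {H : Subgroup SL(2, F)} (hu : ∀ x, upper x ∈ H) {h : SL(2, F)} (hh : h ∈ H)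
    (hc : h 1 0 ≠ 0) {k : SL(2, F)} (hk : k 1 0 = h 1 0) : k ∈ H := by
  have : k = upper ((k 0 0 - h 0 0) / h 1 0) * h * upper ((k 1 1 - h 1 1) / h 1 0) := by
    have d := det_eq h
    have d' := det_eq k
    apply ext4
    · simp; field_simp; ring
    · simp; field_simp
      rw [hk] at d'
      linear_combination d - d'
    · simp [hk]
    · simp; field_simp; ring
  rw [this]
  exact H.mul_mem (H.mul_mem (hu _) hh) (hu _)

lemma eq_top_of_upper_mem {H : Subgroup SL(2, F)} (hu : ∀ x, upper x ∈ H) {h : SL(2, F)}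
    (hh : h ∈ H) (hc : h 1 0 ≠ 0) : H = ⊤ := by
  have hw : (⟨!![0, -(h 1 0)⁻¹; h 1 0, 0], by rw [Matrix.det_fin_two_of]; field_simp; ring⟩ :
      SL(2, F)) ∈ H := mem_of_upper_mem hu hh hc rfl
  set w : SL(2, F) := ⟨!![0, -(h 1 0)⁻¹; h 1 0, 0], by rw [Matrix.det_fin_two_of]; field_simp; ring⟩
  have e00 : w 0 0 = 0 := rfl
  have e01 : w 0 1 = -(h 1 0)⁻¹ := rfl
  have e10 : w 1 0 = h 1 0 := rfl
  have e11 : w 1 1 = 0 := rfl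
  have hl : ∀ x, lower x ∈ H := by
    intro x
    have : lower x = w * upper (-x / (h 1 0) ^ 2) * w⁻¹ := by
      apply ext4 <;> (simp [e00, e01, e10, e11, hc]; try field_simp)
    rw [this]
    exact H.mul_mem (H.mul_mem hw (hu _)) (H.inv_mem hw)
  have hne : ∀ k : SL(2, F), k 1 0 ≠ 0 → k ∈ H := fun k hk =>
    mem_of_upper_mem hu (hl (k 1 0)) hk rfl
  rw [eq_top_iff]
  intro k _
  by_cases hk : k 1 0 = 0
  · have d := det_eq k
    have h1 : ((lower 1 : SL(2, F)) * k) 1 0 ≠ 0 := by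
      simp only [mul_entry, lower_10, lower_11, hk]
      rintro h0
      rw [hk] at d
      have : k 0 0 = 0 := by simpa using h0
      simp [this] at d
    exact (H.mul_mem_cancel_left (hl 1)).1 (hne _ h1)
  · exact hne k hk

/-- Conjugation by the torus multiplies the parameter by squares, and every field element is a
difference of two squares. -/
lemma upper_mem_of_ne_zero [Finite F] {H : Subgroup SL(2, F)} (hd : ∀ s, diag s ∈ H) {x₀ : F}
    (hx₀ : x₀ ≠ 0) (h : upper x₀ ∈ H) (x : F) : upper x ∈ H := by
  have hsq : ∀ a y : F, upper y ∈ H → upper (a ^ 2 * y) ∈ H := by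
    intro a y hy
    by_cases ha : a = 0
    · simp [ha]
    · have := diag_conj_upper (Units.mk0 a ha) y
      rw [Units.val_mk0] at this
      rw [← this]
      exact H.mul_mem (H.mul_mem (hd _) hy) (H.inv_mem (hd _))
  obtain ⟨a, b, hab⟩ := exists_sq_sub_sq (x / x₀)
  have : x = a ^ 2 * x₀ + -(b ^ 2 * x₀) := by
    field_simp at hab
    rw [hab]; ring
  rw [this, upper_add, ← upper_inv]
  exact H.mul_mem (hsq _ _ h) (H.inv_mem (hsq _ _ h))

lemma eq_top_of_triangular_mem [Finite F] (hq : 4 ≤ Nat.card F) {H : Subgroup SL(2, F)}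
    (hd : ∀ s, diag s ∈ H) {h k : SL(2, F)} (hh : h ∈ H) (hc : h 1 0 ≠ 0) (hk : k ∈ H)
    (hk0 : k 1 0 = 0) (hk1 : k 0 1 ≠ 0) : H = ⊤ := by
  obtain ⟨s, hs⟩ := exists_unit_sq_ne_one hq
  have d := det_eq k
  have hk00 : k 0 0 ≠ 0 := by
    intro h0; simp [h0, hk0] at d
  refine eq_top_of_upper_mem (upper_mem_of_ne_zero hd
    (x₀ := ((s : F) ^ 2 - 1) * k 0 1 * k 0 0) ?_ ?_) hh hc
  · exact mul_ne_zero (mul_ne_zero (sub_ne_zero.2 hs) hk1) hk00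
  -- The commutator of a torus element with a triangular nondiagonal one is a nontrivial
  -- unitriangular element.
  · have : upper (((s : F) ^ 2 - 1) * k 0 1 * k 0 0) = diag s * k * (diag s)⁻¹ * k⁻¹ := by
      rw [hk0] at d
      have hs0 := s.ne_zero
      apply ext4 <;> simp [hk0] <;> field_simp
      · linear_combination -d
      · ring
      · linear_combination -d
    rw [this]
    exact H.mul_mem (H.mul_mem (H.mul_mem (hd s) hk) (H.inv_mem (hd s))) (H.inv_mem hk)

/-- The square condition provides a torus element making the first column of `k` proportional to
that of `l`. The resulting quotient in `H` is triangular, hence diagonal by `hH`, so the second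
columns are proportional too and the torus-invariant ratio `k₀₁k₁₀ / k₀₀k₁₁` agrees for `k` and `l`.
-/
lemma cross_ratio_eq_of_isSquare {H : Subgroup SL(2, F)} (hd : ∀ s, diag s ∈ H)
    (hH : ∀ k ∈ H, k 1 0 = 0 → k 0 1 = 0) {k l : SL(2, F)} (hk : k ∈ H) (hl : l ∈ H)
    (hk0 : k 0 0 ≠ 0) (hk1 : k 1 0 ≠ 0) (hl0 : l 0 0 ≠ 0) (hl1 : l 1 0 ≠ 0)
    (hsq : IsSquare ((k 0 0 * k 1 0) * (l 0 0 * l 1 0))) :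
    k 0 1 * k 1 0 * (l 0 0 * l 1 1) = k 0 0 * k 1 1 * (l 0 1 * l 1 0) := by
  obtain ⟨w, hw⟩ := hsq
  have hw0 : w ≠ 0 := by
    rintro rfl
    simp [hk0, hk1, hl0, hl1] at hw
  set r : Fˣ := Units.mk0 (w / (k 1 0 * l 0 0)) (div_ne_zero hw0 (mul_ne_zero hk1 hl0)) with hr
  have hr2 : (r : F) ^ 2 * l 0 0 * k 1 0 = l 1 0 * k 0 0 := by
    rw [hr, Units.val_mk0]; field_simp; linear_combination -hw
  have hr0 : (r : F) ≠ 0 := r.ne_zero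
  have hm := hH (l⁻¹ * ((diag r)⁻¹ * k)) (H.mul_mem (H.inv_mem hl) (H.mul_mem (H.inv_mem (hd r)) hk))
    (by simp; field_simp; linear_combination hr2)
  simp at hm
  field_simp at hm
  apply mul_left_cancel₀ (mul_ne_zero hk0 hl1)
  linear_combination (k 1 0 * l 0 0 * k 0 0 * l 1 0) * hm + (k 0 0 * l 1 0 * k 1 1 * l 0 1) * hr2

lemma card_units_sq [Finite F] [DecidableEq F] [Fintype Fˣ] :
    Nat.card F ≤ 2 * (Finset.univ.image fun s : Fˣ => (s : F) ^ 2).card + 1 := by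
  rw [Nat.card_eq_card_units_add_one F, Nat.card_eq_fintype_card]
  apply Nat.succ_le_succ
  rw [← Finset.card_univ]
  apply Finset.card_le_mul_card_image
  intro y hy
  obtain ⟨t, _, rfl⟩ := Finset.mem_image.1 hy
  refine (Finset.card_le_card (t := {t, -t}) ?_).trans Finset.card_le_two
  intro s hs
  have := (Finset.mem_filter.1 hs).2
  rcases sq_eq_sq_iff_eq_or_eq_neg.1 this with h | h
  · simp [Units.ext h]
  · have : s = -t := Units.ext (by simpa using h)
    simp [this]

/-- A subgroup of `SL₂(q)` containing the diagonal torus and an element of nonzero trace with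
nonzero off-diagonal entries is everything, provided `q` is not small. -/
theorem eq_top_of_diag_mem [Finite F] (hq : 16 ≤ Nat.card F) {H : Subgroup SL(2, F)}
    (hd : ∀ s, diag s ∈ H) {h : SL(2, F)} (hh : h ∈ H) (hb : h 0 1 ≠ 0) (hc : h 1 0 ≠ 0)
    (ht : tr h ≠ 0) : H = ⊤ := by
  classical
  have := Fintype.ofFinite Fˣ
  by_cases hH : ∀ k ∈ H, k 1 0 = 0 → k 0 1 = 0
  swap
  · push Not at hH
    obtain ⟨k, hk, hk0, hk1⟩ := hH
    exact eq_top_of_triangular_mem (by omega) hd hh hc hk hk0 hk1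
  exfalso
  have det := det_eq h
  obtain ⟨a, ha⟩ : ∃ a, a = h 0 0 := ⟨_, rfl⟩
  obtain ⟨b, hb'⟩ : ∃ a, a = h 0 1 := ⟨_, rfl⟩
  obtain ⟨c, hc'⟩ : ∃ a, a = h 1 0 := ⟨_, rfl⟩
  obtain ⟨d, hd'⟩ : ∃ a, a = h 1 1 := ⟨_, rfl⟩
  rw [← ha, ← hb', ← hc', ← hd'] at det
  rw [← hb'] at hb
  rw [← hc'] at hc
  rw [tr, ← ha, ← hd'] at ht
  -- Too many elements of this family lie in `H` for all their invariant ratios to agree. With `y =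
  -- s²`, the ratio is `bc(ay + d)² / ((a²y + bc)(bcy + d²))`.
  let k : Fˣ → SL(2, F) := fun s => h * (diag s * h)
  have hkH : ∀ s, k s ∈ H := fun s => H.mul_mem hh (H.mul_mem (hd s) hh)
  have k00 : ∀ s : Fˣ, k s 0 0 = (a ^ 2 * (s : F) ^ 2 + b * c) / s := fun s => by
    simp [k, ← ha, ← hb', ← hc']; field_simp
  have k01 : ∀ s : Fˣ, k s 0 1 = b * (a * (s : F) ^ 2 + d) / s := fun s => by
    simp [k, ← ha, ← hb', ← hd']; field_simp
  have k10 : ∀ s : Fˣ, k s 1 0 = c * (a * (s : F) ^ 2 + d) / s := fun s => by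
    simp [k, ← ha, ← hc', ← hd']; field_simp
  have k11 : ∀ s : Fˣ, k s 1 1 = (b * c * (s : F) ^ 2 + d ^ 2) / s := fun s => by
    simp [k, ← hb', ← hc', ← hd']; field_simp
  obtain ⟨Y, hY⟩ : ∃ Y : Finset F, Y = Finset.univ.image fun s : Fˣ => (s : F) ^ 2 := ⟨_, rfl⟩
  -- The erased values of `s²` are those at which an entry of the first column vanishes. For `a = 0`
  -- both quotients are `0` by convention, and then no exclusion is needed since `d` is the nonzero
  -- trace.
  obtain ⟨Y', hY'⟩ : ∃ Y', Y' = (Y.erase (-(b * c) / a ^ 2)).erase (-d / a) := ⟨_, rfl⟩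
  have hYcard : 5 ≤ Y'.card := by
    have h1 : Nat.card F ≤ 2 * Y.card + 1 := hY ▸ card_units_sq
    have h2 := Finset.pred_card_le_card_erase (s := Y) (a := -(b * c) / a ^ 2)
    have h3 := Finset.pred_card_le_card_erase (s := Y.erase (-(b * c) / a ^ 2)) (a := -d / a)
    rw [← hY'] at h3
    omega
  have hgood : ∀ s : Fˣ, (s : F) ^ 2 ∈ Y' → k s 0 0 ≠ 0 ∧ k s 1 0 ≠ 0 := by
    intro s hs
    rw [hY', Finset.mem_erase, Finset.mem_erase] at hs
    obtain ⟨h1, h2, -⟩ := hs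
    rw [k00, k10]
    constructor
    · refine div_ne_zero (fun h0 => ?_) s.ne_zero
      by_cases ha0 : a = 0
      · rw [ha0] at h0; exact mul_ne_zero hb hc (by linear_combination h0)
      · apply h2; field_simp; linear_combination h0
    · refine div_ne_zero (mul_ne_zero hc (fun h0 => ?_)) s.ne_zero
      by_cases ha0 : a = 0
      · apply ht
        rw [ha0] at h0 ⊢
        linear_combination h0
      · apply h1; field_simp; linear_combination h0
  have hpair : ∀ s t : Fˣ, (s : F) ^ 2 ∈ Y' → (t : F) ^ 2 ∈ Y' →
      (IsSquare (k s 0 0 * k s 1 0) ↔ IsSquare (k t 0 0 * k t 1 0)) → (s : F) ^ 2 ≠ (t : F) ^ 2 →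
      a ^ 2 * (s : F) ^ 2 * (t : F) ^ 2 = d ^ 2 := by
    intro s t hs ht hst hne
    obtain ⟨s0, s1⟩ := hgood s hs
    obtain ⟨t0, t1⟩ := hgood t ht
    have key := cross_ratio_eq_of_isSquare hd hH (hkH s) (hkH t) s0 s1 t0 t1
      (isSquare_mul_of_iff (mul_ne_zero s0 s1) (mul_ne_zero t0 t1) hst)
    simp only [k00, k01, k10, k11] at key
    have hs0 := s.ne_zero
    have ht0 := t.ne_zero
    field_simp at key
    apply mul_left_cancel₀ (sub_ne_zero.2 hne)
    linear_combination key - ((a * (s : F) ^ 2 + d) ^ 2 * (t : F) ^ 2 -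
      (a * (t : F) ^ 2 + d) ^ 2 * (s : F) ^ 2) * (a * d - b * c + 1) * det
  have hroot : ∀ y : F, ∃ s : Fˣ, y ∈ Y' → (s : F) ^ 2 = y := by
    intro y
    by_cases hy : y ∈ Y'
    · rw [hY'] at hy
      have hy' := Finset.mem_of_mem_erase (Finset.mem_of_mem_erase hy)
      rw [hY] at hy'
      obtain ⟨s, -, hs⟩ := Finset.mem_image.1 hy'
      exact ⟨s, fun _ => hs⟩
    · exact ⟨1, fun h => absurd h hy⟩
  choose g hg using hroot
  -- Five values in two square classes leave three in one class. Then `a²y₁y₂ = d² = a²y₁y₃` forces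
  -- `a = d = 0`, against the nonzero trace.
  obtain ⟨e, -, hcard⟩ := Finset.exists_lt_card_fiber_of_mul_lt_card_of_maps_to
    (s := Y') (t := (Finset.univ : Finset Bool))
    (f := fun y => decide (IsSquare (k (g y) 0 0 * k (g y) 1 0)))
    (fun _ _ => Finset.mem_univ _) (n := 2) (by simp; omega)
  obtain ⟨y₁, y₂, y₃, h1, h2, h3, h12, h13, h23⟩ := Finset.two_lt_card_iff.1 hcard
  rw [Finset.mem_filter] at h1 h2 h3
  have hp : ∀ y z, y ∈ Y' → z ∈ Y' → decide (IsSquare (k (g y) 0 0 * k (g y) 1 0)) = e →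
      decide (IsSquare (k (g z) 0 0 * k (g z) 1 0)) = e → y ≠ z → a ^ 2 * y * z = d ^ 2 := by
    intro y z hy hz hye hze hyz
    have := hpair (g y) (g z) (by rwa [hg y hy]) (by rwa [hg z hz])
      (decide_eq_decide.1 (hye.trans hze.symm)) (by rwa [hg y hy, hg z hz])
    rwa [hg y hy, hg z hz] at this
  have e12 := hp y₁ y₂ h1.1 h2.1 h1.2 h2.2 h12
  have e13 := hp y₁ y₃ h1.1 h3.1 h1.2 h3.2 h13
  have hy1 : y₁ ≠ 0 := by
    rw [← hg y₁ h1.1]; exact pow_ne_zero 2 (g y₁).ne_zero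
  have ha0 : a = 0 := by
    have : a ^ 2 * y₁ * (y₂ - y₃) = 0 := by linear_combination e12 - e13
    simpa [hy1, sub_ne_zero.2 h23] using this
  rw [ha0] at e12
  have hd0 : d = 0 := by
    have : d ^ 2 = 0 := by rw [← e12]; ring
    simpa using this
  exact ht (by rw [ha0, hd0, add_zero])

end SL2

/-! ### Split and nonsplit classes -/

namespace SL2

variable {F : Type u} [Field F]

/-- The polynomial `X² - tX + 1` has no root. -/
def Nonsplit (t : F) : Prop := ∀ l : F, l ^ 2 - t * l + 1 ≠ 0

lemma Nonsplit.neg {t : F} (h : Nonsplit t) : Nonsplit (-t) := fun l hl =>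
  h (-l) (by linear_combination hl)

lemma nonsplit_neg {t : F} : Nonsplit (-t) ↔ Nonsplit t :=
  ⟨fun h => by simpa using h.neg, Nonsplit.neg⟩

lemma Nonsplit.ne_two {t : F} (h : Nonsplit t) : t ≠ 2 := by
  rintro rfl; exact h 1 (by ring)

lemma Nonsplit.ne_neg_two {t : F} (h : Nonsplit t) : t ≠ -2 := by
  rintro rfl; exact h (-1) (by ring)

lemma Nonsplit.entry_10_ne_zero {A : SL(2, F)} (h : Nonsplit (tr A)) : A 1 0 ≠ 0 := by
  intro h0
  have d := det_eq A
  refine h (A 0 0) ?_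
  simp only [tr]
  linear_combination -d - A 0 1 * h0

lemma Nonsplit.entry_01_ne_zero {A : SL(2, F)} (h : Nonsplit (tr A)) : A 0 1 ≠ 0 := by
  intro h0
  have d := det_eq A
  refine h (A 0 0) ?_
  simp only [tr]
  linear_combination -d - A 1 0 * h0

/-- The conjugacy class consists of elements without eigenvalue in `F`. -/
def IsNonsplitClass (C : ConjClasses PSL(2, F)) : Prop :=
  ∃ A : SL(2, F), ConjClasses.mk (A : PSL(2, F)) = C ∧ Nonsplit (tr A)

lemma tr_eq_or_of_mk_eq_mk {A B : SL(2, F)}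
    (h : ConjClasses.mk (A : PSL(2, F)) = ConjClasses.mk (B : PSL(2, F))) :
    tr A = tr B ∨ tr A = -tr B := by
  rw [ConjClasses.mk_eq_mk_iff_isConj, isConj_mk_iff] at h
  rcases h with h | h
  · exact Or.inl (tr_eq_of_isConj h)
  · exact Or.inr (by rw [tr_eq_of_isConj h, tr_neg])

lemma isNonsplitClass_mk {A : SL(2, F)} :
    IsNonsplitClass (ConjClasses.mk (A : PSL(2, F))) ↔ Nonsplit (tr A) := by
  constructor
  · rintro ⟨B, hB, h⟩
    rcases tr_eq_or_of_mk_eq_mk hB with e | e <;> rw [e] at h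
    · exact h
    · exact nonsplit_neg.1 h
  · exact fun h => ⟨A, rfl, h⟩

lemma exists_lift (C : ConjClasses PSL(2, F)) : ∃ A : SL(2, F), ConjClasses.mk (A : PSL(2, F)) = C := by
  obtain ⟨x, rfl⟩ := ConjClasses.exists_rep C
  obtain ⟨A, rfl⟩ := QuotientGroup.mk_surjective x
  exact ⟨A, rfl⟩

variable (F) in
/-- The subgroup of upper triangular matrices. -/
def borel : Subgroup SL(2, F) where
  carrier := {A | A 1 0 = 0}
  one_mem' := one_10
  mul_mem' := by
    intro A B hA hB
    change (A * B) 1 0 = 0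
    rw [mul_entry, show A 1 0 = 0 from hA, show B 1 0 = 0 from hB]; ring
  inv_mem' := by
    intro A hA
    change A⁻¹ 1 0 = 0
    rw [inv_10, show A 1 0 = 0 from hA, neg_zero]

/-- An eigenvalue in `F` makes a class meet the image of the Borel subgroup, which is proper because
it misses `comp 0`. -/
lemma not_invGen_of_split {C D : ConjClasses PSL(2, F)} (hC : ¬IsNonsplitClass C)
    (hD : ¬IsNonsplitClass D) : ¬InvGen C D := by
  have key : ∀ C : ConjClasses PSL(2, F), ¬IsNonsplitClass C →
      ∃ A ∈ borel F, ConjClasses.mk (A : PSL(2, F)) = C := by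
    intro C hC
    obtain ⟨A, rfl⟩ := exists_lift C
    rw [isNonsplitClass_mk, Nonsplit] at hC
    push Not at hC
    obtain ⟨l, hl⟩ := hC
    obtain ⟨P, hP⟩ := exists_conj_triangular hl
    refine ⟨_, hP, ?_⟩
    rw [ConjClasses.mk_eq_mk_iff_isConj]
    exact (isConj_mk (isConj_iff.2 ⟨P, rfl⟩)).symm
  intro h
  obtain ⟨A, hA, rfl⟩ := key C hC
  obtain ⟨B, hB, rfl⟩ := key D hD
  have hgen := h _ _ rfl rfl
  have hle : Subgroup.closure {(A : PSL(2, F)), (B : PSL(2, F))} ≤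
      (borel F).map (QuotientGroup.mk' (Subgroup.center SL(2, F))) := by
    rw [Subgroup.closure_le]
    rintro _ (rfl | rfl)
    · exact ⟨A, hA, rfl⟩
    · exact ⟨B, hB, rfl⟩
  rw [hgen] at hle
  obtain ⟨K, hK, hKe⟩ := hle (show ((comp 0 : SL(2, F)) : PSL(2, F)) ∈ _ from trivial)
  have hK0 : K 1 0 = 0 := hK
  rcases mk_eq_iff.1 hKe with rfl | rfl
  · simp at hK0
  · simp at hK0

lemma upper_lower_not_comm : ((upper 1 : SL(2, F)) : PSL(2, F)) * ((lower 1 : SL(2, F)) : PSL(2, F))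
    ≠ ((lower 1 : SL(2, F)) : PSL(2, F)) * ((upper 1 : SL(2, F)) : PSL(2, F)) := by
  rw [← QuotientGroup.mk_mul, ← QuotientGroup.mk_mul, Ne, mk_eq_iff]
  rintro (h | h)
  · have := congrArg (fun A : SL(2, F) => A 0 0) h
    simp at this
  · have h0 := congrArg (fun A : SL(2, F) => A 0 0) h
    have h1 := congrArg (fun A : SL(2, F) => A 0 1) h
    simp only [mul_entry, neg_entry, upper_00, upper_01, upper_10, upper_11, lower_00, lower_01,
      lower_10, lower_11] at h0 h1
    exact one_ne_zero (α := F) (by linear_combination h0 - h1)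

variable (F) in
lemma exists_mul_ne_mul : ∃ a b : PSL(2, F), a * b ≠ b * a := ⟨_, _, upper_lower_not_comm⟩

-- Both polynomials define the quadratic extension of `F`, so a root of the second is `x + y r` with
-- `r` a root of the first; its trace is `t'` and its norm is `1`.
open Polynomial in
lemma exists_norm_one_of_nonsplit [Finite F] {t t' : F} (ht : Nonsplit t) (ht' : Nonsplit t') :
    ∃ x y : F, t' = 2 * x + t * y ∧ x ^ 2 + t * x * y + y ^ 2 = 1 := by
  have hdeg : ∀ a : F, (X ^ 2 - C a * X + 1 : F[X]).natDegree = 2 := fun a => by compute_degree!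
  have hirr : ∀ a : F, Nonsplit a → Irreducible (X ^ 2 - C a * X + 1 : F[X]) := by
    intro a ha
    apply irreducible_of_degree_le_three_of_not_isRoot
    · rw [hdeg]; decide
    · intro l hl
      apply ha l
      simpa using hl
  have : Fact (Irreducible (X ^ 2 - C t * X + 1 : F[X])) := ⟨hirr t ht⟩
  have : Fact (Irreducible (X ^ 2 - C t' * X + 1 : F[X])) := ⟨hirr t' ht'⟩
  let f : F[X] := X ^ 2 - C t * X + 1
  let g : F[X] := X ^ 2 - C t' * X + 1
  have hf0 : f ≠ 0 := (hirr t ht).ne_zero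
  have hg0 : g ≠ 0 := (hirr t' ht').ne_zero
  have : Module.Finite F (AdjoinRoot f) := (AdjoinRoot.powerBasis hf0).finite
  have : Finite (AdjoinRoot f) := Module.finite_of_finite F
  have e1 : Module.finrank F (AdjoinRoot f) = 2 := by
    rw [(AdjoinRoot.powerBasis hf0).finrank, AdjoinRoot.powerBasis_dim, hdeg]
  have e2 : Module.finrank F (AdjoinRoot g) = 2 := by
    rw [(AdjoinRoot.powerBasis hg0).finrank, AdjoinRoot.powerBasis_dim, hdeg]
  obtain ⟨φ⟩ := FiniteField.nonempty_algHom_of_finrank_dvd (F := F) (K := AdjoinRoot g)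
    (L := AdjoinRoot f) (by rw [e1, e2])
  set r := AdjoinRoot.root f
  obtain ⟨of, hof⟩ : ∃ of : F →+* AdjoinRoot f, of = algebraMap F (AdjoinRoot f) := ⟨_, rfl⟩
  have hr : r ^ 2 - of t * r + 1 = 0 := by
    have : aeval r f = 0 := by rw [AdjoinRoot.aeval_eq, AdjoinRoot.mk_self]
    simpa only [f, map_add, map_sub, map_mul, map_pow, map_one, aeval_X, aeval_C, ← hof] using this
  have hs : (φ (AdjoinRoot.root g)) ^ 2 - of t' * (φ (AdjoinRoot.root g)) + 1 = 0 := by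
    have : aeval (φ (AdjoinRoot.root g)) g = 0 := by
      rw [aeval_algHom_apply, AdjoinRoot.aeval_eq, AdjoinRoot.mk_self, map_zero]
    simpa only [g, map_add, map_sub, map_mul, map_pow, map_one, aeval_X, aeval_C, ← hof] using this
  have hspan : ∀ z : AdjoinRoot f, ∃ x y : F, z = of x + of y * r := by
    intro z
    obtain ⟨p, rfl⟩ := AdjoinRoot.mk_surjective z
    have hm : f.Monic := by unfold f; monicity!
    have hp : AdjoinRoot.mk f p = AdjoinRoot.mk f (p %ₘ f) := by
      rw [AdjoinRoot.mk_eq_mk]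
      exact ⟨p /ₘ f, by linear_combination -(modByMonic_add_div p f)⟩
    obtain ⟨b, a, hab⟩ := exists_eq_X_add_C_of_natDegree_le_one (p := p %ₘ f) (by
      have := natDegree_modByMonic_lt p hm (by
        intro h1
        have h2 := hdeg t
        rw [show X ^ 2 - C t * X + 1 = f from rfl, h1, natDegree_one] at h2
        omega)
      rw [show f.natDegree = 2 from hdeg t] at this
      omega)
    refine ⟨a, b, ?_⟩
    rw [hp, hab, map_add, map_mul, AdjoinRoot.mk_C, AdjoinRoot.mk_C, AdjoinRoot.mk_X, hof,
      AdjoinRoot.algebraMap_eq]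
    ring
  obtain ⟨x, y, hxy⟩ := hspan (φ (AdjoinRoot.root g))
  rw [hxy] at hs
  have hind : ∀ a b : F, of a + of b * r = 0 → a = 0 ∧ b = 0 := by
    intro a b h
    have hb : b = 0 := by
      by_contra hb
      have hob : of b ≠ 0 := (map_ne_zero of).2 hb
      apply ht (-a / b)
      apply of.injective
      have hrb : of (-a / b) = r := by
        rw [map_div₀, map_neg, div_eq_iff hob]; linear_combination -h
      rw [map_add, map_sub, map_mul, map_pow, map_one, map_zero, hrb, hr]
    rw [hb, map_zero, zero_mul, add_zero] at h
    exact ⟨(map_eq_zero of).1 h, hb⟩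
  -- Coefficients of `1` and `r` in the equation of `x + y r`, reduced by `r² = t r - 1`.
  have e := hind (x ^ 2 - y ^ 2 - t' * x + 1) (2 * x * y + t * y ^ 2 - t' * y) (by
    simp only [map_add, map_sub, map_mul, map_pow, map_one, map_ofNat]
    linear_combination hs - of y ^ 2 * hr)
  have hy : y ≠ 0 := by
    rintro rfl
    exact ht' x (by linear_combination e.1)
  have e' : t' = 2 * x + t * y := by
    apply mul_left_cancel₀ hy
    linear_combination -e.2
  refine ⟨x, y, e', ?_⟩
  rw [e'] at e
  linear_combination -e.1

lemma mk_comp_eq_mk [Finite F] {A : SL(2, F)} {t : F} (ht1 : t ≠ 2) (ht2 : t ≠ -2) (h : tr A = t) :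
    ConjClasses.mk ((comp t : SL(2, F)) : PSL(2, F)) = ConjClasses.mk (A : PSL(2, F)) := by
  subst h
  rw [ConjClasses.mk_eq_mk_iff_isConj]
  exact isConj_mk (isConj_comp ht1 ht2)

/-- The second class has a representative `E = x + y · comp t` commuting with `comp t`, where `t` is
the trace of the first, and commuting elements cannot generate a nonabelian group. -/
lemma not_invGen_of_nonsplit [Finite F] {C D : ConjClasses PSL(2, F)} (hC : IsNonsplitClass C)
    (hD : IsNonsplitClass D) : ¬InvGen C D := by
  obtain ⟨A, rfl, hA⟩ := hC
  obtain ⟨B, rfl, hB⟩ := hD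
  rw [← mk_comp_eq_mk hA.ne_two hA.ne_neg_two rfl]
  obtain ⟨x, y, hx, hxy⟩ := exists_norm_one_of_nonsplit hA hB
  let E : SL(2, F) := ⟨!![x, -y; y, x + tr A * y], by
    rw [Matrix.det_fin_two_of]; linear_combination hxy⟩
  have hE : tr E = tr B := by
    change x + (x + tr A * y) = tr B
    rw [hx]; ring
  rw [← mk_comp_eq_mk hB.ne_two hB.ne_neg_two rfl, mk_comp_eq_mk hB.ne_two hB.ne_neg_two hE]
  intro h
  have hgen := h _ _ rfl rfl
  have hcomm : (comp (tr A)) * E = E * comp (tr A) := by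
    have e00 : E 0 0 = x := rfl
    have e01 : E 0 1 = -y := rfl
    have e10 : E 1 0 = y := rfl
    have e11 : E 1 1 = x + tr A * y := rfl
    apply ext4 <;> simp only [mul_entry, e00, e01, e10, e11, comp_00, comp_01, comp_10, comp_11] <;>
      ring
  refine not_commute_of_closure_pair_eq_top (exists_mul_ne_mul F) hgen ?_
  rw [← QuotientGroup.mk_mul, hcomm, QuotientGroup.mk_mul]

end SL2

open SL2 in
/-- In an invariably generating pair exactly one of the classes is nonsplit. -/
lemma InvGen.isNonsplitClass_iff {F : Type u} [Field F] [Finite F] {C D : ConjClasses PSL(2, F)} (h : InvGen C D) :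
    IsNonsplitClass C ↔ ¬IsNonsplitClass D :=
  ⟨fun hC hD => not_invGen_of_nonsplit hC hD h, fun hD => by
    by_contra hC; exact not_invGen_of_split hC hD h⟩

namespace SL2

/-! ### Automorphisms of `PSL₂(q)` act on traces through field automorphisms -/

variable {F : Type u} [Field F]

lemma mk_upper_injective {x y : F}
    (h : ((upper x : SL(2, F)) : PSL(2, F)) = ((upper y : SL(2, F)) : PSL(2, F))) : x = y := by
  rcases mk_eq_iff.1 h with h | h
  · exact congrArg (fun A : SL(2, F) => A 0 1) h
  · have h0 := congrArg (fun A : SL(2, F) => A 0 0) h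
    have h1 := congrArg (fun A : SL(2, F) => A 0 1) h
    simp only [neg_entry, upper_00, upper_01] at h0 h1
    linear_combination h1 - y * h0

/-- Commuting modulo sign is genuine commuting: outside characteristic two the minus sign would kill
the bottom row of `K`. The centralizer is then read off entrywise. -/
lemma exists_upper_of_comm {a : F} (ha : a ≠ 0) {k : PSL(2, F)}
    (h : k * ((upper a : SL(2, F)) : PSL(2, F)) = ((upper a : SL(2, F)) : PSL(2, F)) * k) :
    ∃ x : F, k = ((upper x : SL(2, F)) : PSL(2, F)) := by
  obtain ⟨K, rfl⟩ := QuotientGroup.mk_surjective k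
  rw [← QuotientGroup.mk_mul, ← QuotientGroup.mk_mul, mk_eq_iff] at h
  have hpos : K * upper a = upper a * K := by
    rcases h with h | h
    · exact h
    have h00 := congrArg (fun A : SL(2, F) => A 0 0) h
    have h10 := congrArg (fun A : SL(2, F) => A 1 0) h
    have h11 := congrArg (fun A : SL(2, F) => A 1 1) h
    simp only [mul_entry, neg_entry, upper_00, upper_01, upper_10, upper_11] at h00 h10 h11
    by_cases h2 : (2 : F) = 0
    · rw [h]
      have hneg : ∀ x : F, -x = x := fun x => by linear_combination -x * h2
      apply ext4 <;> rw [neg_entry, hneg]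
    · exfalso
      have d := det_eq K
      have e10 : K 1 0 = 0 := (mul_eq_zero.1 (show 2 * K 1 0 = 0 by linear_combination h10)).resolve_left h2
      have e11 : K 1 1 = 0 := (mul_eq_zero.1 (show 2 * K 1 1 = 0 by
        linear_combination h11 - a * e10)).resolve_left h2
      rw [e10, e11] at d
      simp at d
  have h00 := congrArg (fun A : SL(2, F) => A 0 0) hpos
  have h01 := congrArg (fun A : SL(2, F) => A 0 1) hpos
  simp only [mul_entry, upper_00, upper_01, upper_10, upper_11] at h00 h01
  have e10 : K 1 0 = 0 := (mul_eq_zero.1 (show a * K 1 0 = 0 by linear_combination -h00)).resolve_left ha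
  have e11 : K 1 1 = K 0 0 := mul_left_cancel₀ ha (by linear_combination -h01)
  have d := det_eq K
  rw [e10, e11] at d
  have hsq : K 0 0 = 1 ∨ K 0 0 = -1 := sq_eq_one_iff.1 (by linear_combination d)
  rcases hsq with h1 | h1
  · refine ⟨K 0 1, ?_⟩
    rw [mk_eq_iff]; left
    apply ext4 <;> simp [h1, e10, e11]
  · refine ⟨-K 0 1, ?_⟩
    rw [mk_eq_iff]; right
    apply ext4 <;> simp [h1, e10, e11]

lemma comp_conj_upper (x : F) : comp 0 * upper x * (comp 0)⁻¹ = lower (-x) := by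
  apply ext4 <;> simp

lemma comp_conj_lower (x : F) : comp 0 * lower x * (comp 0)⁻¹ = upper (-x) := by
  apply ext4 <;> simp

lemma upper_conj_10 (K : SL(2, F)) (x : F) : (K * upper x * K⁻¹) 1 0 = -x * K 1 0 ^ 2 := by
  simp; ring

lemma upper_conj_01 (K : SL(2, F)) (x : F) : (K * upper x * K⁻¹) 0 1 = x * K 0 0 ^ 2 := by
  simp; ring

lemma lower_conj_10 (K : SL(2, F)) (x : F) : (K * lower x * K⁻¹) 1 0 = x * K 1 1 ^ 2 := by
  simp; ring

lemma entry_eq_zero_of_mk_eq {A B : SL(2, F)} (h : (A : PSL(2, F)) = B) {i j : Fin 2}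
    (hB : B i j = 0) : A i j = 0 := by
  rcases mk_eq_iff.1 h with rfl | rfl
  · exact hB
  · rw [neg_entry, hB, neg_zero]

lemma exists_lower_of_comm {a : F} (ha : a ≠ 0) {k : PSL(2, F)}
    (h : k * ((lower a : SL(2, F)) : PSL(2, F)) = ((lower a : SL(2, F)) : PSL(2, F)) * k) :
    ∃ x : F, k = ((lower x : SL(2, F)) : PSL(2, F)) := by
  let w : PSL(2, F) := ((comp 0 : SL(2, F)) : PSL(2, F))
  have hw : w * ((lower a : SL(2, F)) : PSL(2, F)) * w⁻¹ = ((upper (-a) : SL(2, F)) : PSL(2, F)) := by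
    rw [← comp_conj_lower]; rfl
  obtain ⟨x, hx⟩ := exists_upper_of_comm (neg_ne_zero.2 ha) (k := w * k * w⁻¹) (by
    rw [← hw]
    calc _ = w * (k * ((lower a : SL(2, F)) : PSL(2, F))) * w⁻¹ := by group
      _ = _ := by rw [h]; group)
  have hw' : w⁻¹ * ((upper x : SL(2, F)) : PSL(2, F)) * w = ((lower (-x) : SL(2, F)) : PSL(2, F)) := by
    have := comp_conj_lower (-x)
    rw [neg_neg] at this
    rw [← this]
    simp only [QuotientGroup.mk_mul, QuotientGroup.mk_inv]
    change w⁻¹ * (w * _ * w⁻¹) * w = _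
    group
  refine ⟨-x, ?_⟩
  rw [← hw', ← hx]
  group

lemma upper_pow (x : F) (n : ℕ) : upper x ^ n = upper (n * x) := by
  induction n with
  | zero => simp
  | succ n ih => rw [pow_succ, ih, ← upper_add]; congr 1; push_cast; ring

/-- By Frobenius `tr (K^q) = (tr K)^q = tr K`, so `K^q = ±1` forces trace `±2`. This characterizes
unipotents group-theoretically, so automorphisms preserve them. -/
lemma exists_isConj_upper_of_pow [Finite F] {k : PSL(2, F)} (h : k ^ Nat.card F = 1) (h1 : k ≠ 1) :
    ∃ a : F, a ≠ 0 ∧ IsConj k ((upper a : SL(2, F)) : PSL(2, F)) := by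
  have := Fintype.ofFinite F
  obtain ⟨K, rfl⟩ := QuotientGroup.mk_surjective k
  rw [← QuotientGroup.mk_pow, ← QuotientGroup.mk_one, mk_eq_iff] at h
  have ht : ∀ A : SL(2, F), tr A = Matrix.trace (A : Matrix (Fin 2) (Fin 2) F) := fun A => by
    rw [Matrix.trace_fin_two]; rfl
  have hp : tr (K ^ Nat.card F) = tr K := by
    rw [ht, ht, Matrix.SpecialLinearGroup.coe_pow, Nat.card_eq_fintype_card,
      FiniteField.trace_pow_card, FiniteField.pow_card]
  have h2 : tr (1 : SL(2, F)) = 2 := by rw [tr, one_00, one_11]; norm_num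
  obtain ⟨a, ha⟩ := exists_conj_upper (A := K) (by
    rw [← hp]
    rcases h with h | h
    · left; rw [h, h2]
    · right; rw [h, tr_neg, h2])
  refine ⟨a, ?_, ha.symm⟩
  rintro rfl
  rw [upper_zero] at ha
  exact h1 (isConj_one_right.1 ha)

lemma upper_pow_card [Finite F] (x : F) :
    ((upper x : SL(2, F)) : PSL(2, F)) ^ Nat.card F = 1 := by
  have := Fintype.ofFinite F
  rw [← QuotientGroup.mk_pow, upper_pow, Nat.card_eq_fintype_card, FiniteField.cast_card_eq_zero]
  simp

/-- Up to inner automorphisms, an automorphism preserves the two root subgroups. -/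
lemma exists_normalized [Finite F] (α : PSL(2, F) ≃* PSL(2, F)) :
    ∃ γ : PSL(2, F) ≃* PSL(2, F), (∀ x, IsConj (α x) (γ x)) ∧ ∃ a b : F, a ≠ 0 ∧ b ≠ 0 ∧
      γ ((upper 1 : SL(2, F)) : PSL(2, F)) = ((upper a : SL(2, F)) : PSL(2, F)) ∧
      γ ((lower 1 : SL(2, F)) : PSL(2, F)) = ((lower b : SL(2, F)) : PSL(2, F)) := by
  have key : ∀ (α : PSL(2, F) ≃* PSL(2, F)) (u : PSL(2, F)), u ^ Nat.card F = 1 → u ≠ 1 →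
      ∃ a : F, a ≠ 0 ∧ IsConj (α u) ((upper a : SL(2, F)) : PSL(2, F)) := by
    intro α u hu hu1
    exact exists_isConj_upper_of_pow (by rw [← map_pow, hu, map_one])
      (by rwa [Ne, EmbeddingLike.map_eq_one_iff])
  obtain ⟨a, ha, hconj⟩ := key α ((upper 1 : SL(2, F)) : PSL(2, F)) (upper_pow_card 1) (by
    rw [Ne, ← QuotientGroup.mk_one, ← upper_zero]
    exact fun h => one_ne_zero (mk_upper_injective h))
  obtain ⟨k, hk⟩ := isConj_iff.1 hconj
  let α₁ := α.trans (MulAut.conj k)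
  have hα₁ : α₁ ((upper 1 : SL(2, F)) : PSL(2, F)) = ((upper a : SL(2, F)) : PSL(2, F)) := hk
  have hlow : ((lower 1 : SL(2, F)) : PSL(2, F)) =
      ((comp 0 : SL(2, F)) : PSL(2, F)) * ((upper (-1) : SL(2, F)) : PSL(2, F)) *
      ((comp 0 : SL(2, F)) : PSL(2, F))⁻¹ := by
    have := comp_conj_upper (-1 : F)
    rw [neg_neg] at this
    rw [← this]; rfl
  obtain ⟨c, hc, hconj'⟩ := key α₁ ((lower 1 : SL(2, F)) : PSL(2, F))
    (by rw [hlow, conj_pow, upper_pow_card, mul_one, mul_inv_cancel])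
    (by
      intro h
      apply upper_lower_not_comm (F := F)
      rw [h, mul_one, one_mul])
  obtain ⟨k₂, hk₂⟩ := isConj_iff.1 hconj'.symm
  obtain ⟨K, rfl⟩ := QuotientGroup.mk_surjective k₂
  -- Otherwise the images of `upper 1` and `lower 1` would both be upper unitriangular and commute.
  have hK : K 1 0 ≠ 0 := by
    intro h0
    have d := det_eq K
    have e : K * upper c * K⁻¹ = upper (c * K 0 0 ^ 2) := by
      apply ext4
      · simp [h0]; linear_combination d + K 0 1 * h0
      · rw [upper_conj_01]; rfl
      · rw [upper_conj_10, h0]; simp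
      · simp [h0]; linear_combination d + K 0 1 * h0
    have e' : α₁ ((lower 1 : SL(2, F)) : PSL(2, F)) = ((upper (c * K 0 0 ^ 2) : SL(2, F)) : PSL(2, F)) := by
      rw [← hk₂, ← e]; rfl
    apply upper_lower_not_comm (F := F)
    apply α₁.injective
    rw [map_mul, map_mul, e', hα₁, ← QuotientGroup.mk_mul, ← QuotientGroup.mk_mul, ← upper_add,
      ← upper_add, add_comm]
  -- Chosen so that `upper l * K` has zero upper left entry and conjugates `upper c` to a lower
  -- unitriangular matrix.
  let l : F := -K 0 0 / K 1 0
  refine ⟨α₁.trans (MulAut.conj ((upper l : SL(2, F)) : PSL(2, F))), fun x => ?_, a,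
    -c * K 1 0 ^ 2, ha, mul_ne_zero (neg_ne_zero.2 hc) (pow_ne_zero 2 hK), ?_, ?_⟩
  · refine isConj_iff.2 ⟨((upper l : SL(2, F)) : PSL(2, F)) * k, ?_⟩
    simp only [α₁, MulEquiv.trans_apply, MulAut.conj_apply]
    group
  · simp only [MulEquiv.trans_apply, MulAut.conj_apply, hα₁]
    rw [mul_inv_eq_iff_eq_mul, ← QuotientGroup.mk_mul, ← QuotientGroup.mk_mul, ← upper_add,
      ← upper_add, add_comm]
  · simp only [MulEquiv.trans_apply, MulAut.conj_apply, ← hk₂]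
    have e : (upper l * K) * upper c * (upper l * K)⁻¹ = lower (-c * K 1 0 ^ 2) := by
      have h00 : (upper l * K) 0 0 = 0 := by simp [l]; field_simp; ring
      have h10 : (upper l * K) 1 0 = K 1 0 := by simp
      have d := det_eq (upper l * K)
      rw [h00, h10] at d
      generalize upper l * K = M at *
      apply ext4
      · simp [h00, h10]; linear_combination d
      · rw [upper_conj_01, h00]; simp
      · rw [upper_conj_10, h10]; rfl
      · simp [h00, h10]; linear_combination d
    rw [← e]
    simp only [QuotientGroup.mk_mul, QuotientGroup.mk_inv]
    group

/-- The image of a torus element normalizes the upper root subgroup, so it is triangular and acts on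
that subgroup by a scalar. -/
lemma exists_map_eq_diag {γ : PSL(2, F) ≃* PSL(2, F)} {f : F → F}
    (hu : ∀ x, γ ((upper x : SL(2, F)) : PSL(2, F)) = ((upper (f x) : SL(2, F)) : PSL(2, F)))
    (ha : f 1 ≠ 0) (s : Fˣ) : ∃ m : F, ∀ x, f ((s : F) ^ 2 * x) = m * f x := by
  obtain ⟨K, hK⟩ := QuotientGroup.mk_surjective (γ ((diag s : SL(2, F)) : PSL(2, F)))
  have hconj : ∀ x, (((K * upper (f x) * K⁻¹ : SL(2, F))) : PSL(2, F)) =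
      ((upper (f ((s : F) ^ 2 * x)) : SL(2, F)) : PSL(2, F)) := by
    intro x
    rw [← hu, ← diag_conj_upper]
    simp only [QuotientGroup.mk_mul, QuotientGroup.mk_inv, map_mul, map_inv, hK, hu]
  have h10 : K 1 0 = 0 := by
    have := entry_eq_zero_of_mk_eq (hconj 1) (i := 1) (j := 0) rfl
    rw [upper_conj_10] at this
    simpa [ha] using this
  have d := det_eq K
  rw [h10] at d
  refine ⟨K 0 0 ^ 2, fun x => ?_⟩
  apply mk_upper_injective
  rw [← hconj]
  congr 1
  apply ext4
  · simp [h10]; linear_combination d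
  · rw [upper_conj_01, upper_01]; ring
  · rw [upper_conj_10, h10]; simp
  · simp [h10]; linear_combination d

/-- Every automorphism of `PSL₂(q)` acts on traces, up to sign, as a field endomorphism. -/
theorem exists_ringHom_tr [Finite F] (α : PSL(2, F) ≃* PSL(2, F)) :
    ∃ φ : F →+* F, ∀ A B : SL(2, F), tr A ≠ 2 → tr A ≠ -2 →
      ConjClasses.mk (α (A : PSL(2, F))) = ConjClasses.mk (B : PSL(2, F)) →
      tr B = φ (tr A) ∨ tr B = -φ (tr A) := by
  obtain ⟨γ, hγ, a, b, ha, hb, hua, hlb⟩ := exists_normalized α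
  have hu : ∀ x, ∃ y, γ ((upper x : SL(2, F)) : PSL(2, F)) = ((upper y : SL(2, F)) : PSL(2, F)) := by
    intro x
    apply exists_upper_of_comm ha
    rw [← hua, ← map_mul, ← map_mul, ← QuotientGroup.mk_mul, ← QuotientGroup.mk_mul, ← upper_add,
      ← upper_add, add_comm]
  have hl : ∀ x, ∃ y, γ ((lower x : SL(2, F)) : PSL(2, F)) = ((lower y : SL(2, F)) : PSL(2, F)) := by
    intro x
    apply exists_lower_of_comm hb
    rw [← hlb, ← map_mul, ← map_mul, ← QuotientGroup.mk_mul, ← QuotientGroup.mk_mul, ← lower_add,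
      ← lower_add, add_comm]
  choose f hf using hu
  choose g hg using hl
  have hf1 : f 1 = a := mk_upper_injective (by rw [← hf, hua])
  have hadd : ∀ x y, f (x + y) = f x + f y := fun x y => mk_upper_injective (by
    rw [← hf, upper_add, QuotientGroup.mk_mul, map_mul, hf, hf, ← QuotientGroup.mk_mul, upper_add])
  have hf0 : f 0 = 0 := by simpa using hadd 0 0
  have hneg : ∀ x, f (-x) = -f x := fun x => by
    have := hadd x (-x)
    rw [add_neg_cancel, hf0] at this
    linear_combination -this
  -- `comp 0` exchanges the two root subgroups, so its image `M` does as well and is antidiagonal.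
  -- Hence `comp t = comp 0 * upper t` goes to an element of trace `M₁₀ f(t)`.
  obtain ⟨M, hM⟩ := QuotientGroup.mk_surjective (γ ((comp 0 : SL(2, F)) : PSL(2, F)))
  have hM00 : M 0 0 = 0 := by
    have : (((M * upper a * M⁻¹ : SL(2, F))) : PSL(2, F)) =
        ((lower (g (-1)) : SL(2, F)) : PSL(2, F)) := by
      rw [← hg, ← comp_conj_upper]
      simp only [QuotientGroup.mk_mul, QuotientGroup.mk_inv, map_mul, map_inv, hM, hua]
    have := entry_eq_zero_of_mk_eq this (i := 0) (j := 1) rfl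
    rw [upper_conj_01] at this
    simpa [ha] using this
  have hM11 : M 1 1 = 0 := by
    have : (((M * lower b * M⁻¹ : SL(2, F))) : PSL(2, F)) =
        ((upper (f (-1)) : SL(2, F)) : PSL(2, F)) := by
      rw [← hf, ← comp_conj_lower]
      simp only [QuotientGroup.mk_mul, QuotientGroup.mk_inv, map_mul, map_inv, hM, hlb]
    have := entry_eq_zero_of_mk_eq this (i := 1) (j := 0) rfl
    rw [lower_conj_10] at this
    simpa [hb] using this
  have hcomp : ∀ t, γ ((comp t : SL(2, F)) : PSL(2, F)) = ((M * upper (f t) : SL(2, F)) : PSL(2, F)) := by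
    intro t
    rw [comp_eq, QuotientGroup.mk_mul, map_mul, ← hM, hf, QuotientGroup.mk_mul]
  have htr : ∀ t, tr (M * upper (f t)) = M 1 0 * f t := fun t => by simp [tr, hM00, hM11]
  have d := det_eq M
  rw [hM00, hM11] at d
  have hM10 : M 1 0 ≠ 0 := by
    intro h; simp [h] at d
  -- The relation `comp 1 ^ 3 = -1` fixes the scale: an element of trace `τ` whose cube is `±1`
  -- satisfies `(τ² - 1) M₁₀ = 0`.
  have hsq : (M 1 0 * f 1) ^ 2 = 1 := by
    have e3 : comp (1 : F) ^ 3 = -1 := by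
      rw [pow_three]
      apply ext4 <;> simp
    have : ((((M * upper (f 1)) ^ 3 : SL(2, F))) : PSL(2, F)) = ((1 : SL(2, F)) : PSL(2, F)) := by
      rw [QuotientGroup.mk_pow, ← hcomp, ← map_pow, ← QuotientGroup.mk_pow, e3, mk_neg,
        QuotientGroup.mk_one, map_one]
    have := entry_eq_zero_of_mk_eq this (i := 1) (j := 0) one_10
    rw [pow_three] at this
    simp only [mul_entry, hM00, hM11, upper_00, upper_01, upper_10, upper_11] at this
    apply mul_left_cancel₀ hM10
    linear_combination this + M 1 0 * d
  have hφ : ∀ t, M 1 0 * f t = f t / f 1 ∨ M 1 0 * f t = -(f t / f 1) := by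
    intro t
    rw [hf1] at hsq ⊢
    rcases sq_eq_one_iff.1 hsq with h | h
    · left; field_simp; linear_combination (f t) * h
    · right; field_simp; linear_combination (f t) * h
  -- `f / f 1` is multiplicative when one factor is a square, and then always, since `f` is additive
  -- and every element is a difference of squares.
  have hmulsq : ∀ s x, f (s ^ 2 * x) * f 1 = f (s ^ 2) * f x := by
    intro s x
    by_cases hs : s = 0
    · simp [hs, hf0]
    · obtain ⟨m, hm⟩ := exists_map_eq_diag hf (hf1 ▸ ha) (Units.mk0 s hs)
      have h1 := hm 1
      have hx := hm x
      rw [Units.val_mk0, mul_one] at h1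
      rw [Units.val_mk0] at hx
      rw [h1, hx]; ring
  have hmul : ∀ x y, f (x * y) * f 1 = f x * f y := by
    intro x y
    obtain ⟨s, r, rfl⟩ := exists_sq_sub_sq x
    have e : (s ^ 2 - r ^ 2) * y = s ^ 2 * y + -(r ^ 2 * y) := by ring
    rw [e, hadd, hneg, sub_eq_add_neg (s ^ 2), hadd, hneg, add_mul, neg_mul, hmulsq, hmulsq]; ring
  have hf10 : f 1 ≠ 0 := hf1 ▸ ha
  refine ⟨{ toFun := fun x => f x / f 1, map_one' := div_self hf10, map_mul' := fun x y => by
              field_simp; exact hmul x y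
            map_zero' := by rw [hf0, zero_div]
            map_add' := fun x y => by rw [hadd, add_div] }, fun A B h2 h2' hAB => ?_⟩
  change tr B = f (tr A) / f 1 ∨ tr B = -(f (tr A) / f 1)
  have h1 : ConjClasses.mk (γ (A : PSL(2, F))) =
      ConjClasses.mk ((M * upper (f (tr A)) : SL(2, F)) : PSL(2, F)) := by
    rw [← hcomp, ← map_mk_mulEquiv, ← map_mk_mulEquiv, mk_comp_eq_mk h2 h2' rfl]
  rw [ConjClasses.mk_eq_mk_iff_isConj.2 (hγ _), h1] at hAB
  rcases tr_eq_or_of_mk_eq_mk hAB with h | h <;> rw [htr] at h <;> rcases hφ (tr A) with h' | h'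
  · left; rw [← h, h']
  · right; rw [← h, h']
  · right; rw [← h', h, neg_neg]
  · left; rw [← neg_inj, ← h', h]

end SL2

/-! ### Arithmetic estimates -/

/-- The `j`-th smallest element is at least `j + 1`, so the product of the `p / (p - 1)` is at most
the telescoping product of the `(j + 1) / j`. -/
lemma Finset.prod_le_card_succ_mul_prod_pred (s : Finset ℕ) (hs : ∀ p ∈ s, 2 ≤ p) :
    ∏ p ∈ s, p ≤ (s.card + 1) * ∏ p ∈ s, (p - 1) := by
  induction s using Finset.induction_on_max with
  | empty => simp
  | insert a s ha ih =>
    have has : a ∉ s := fun h => lt_irrefl _ (ha a h)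
    have ih := ih fun p hp => hs p (Finset.mem_insert_of_mem hp)
    rw [Finset.prod_insert has, Finset.prod_insert has, Finset.card_insert_of_notMem has]
    have hcard : s.card + 2 ≤ a := by
      have hsub : s ⊆ Finset.Ico 2 a := fun p hp =>
        Finset.mem_Ico.2 ⟨hs p (Finset.mem_insert_of_mem hp), ha p hp⟩
      have := Finset.card_le_card hsub
      rw [Nat.card_Ico] at this
      have := hs a (Finset.mem_insert_self a s)
      omega
    obtain ⟨b, rfl⟩ : ∃ b, a = b + 1 := ⟨a - 1, by omega⟩
    rw [Nat.add_sub_cancel]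
    calc (b + 1) * ∏ p ∈ s, p ≤ (b + 1) * ((s.card + 1) * ∏ p ∈ s, (p - 1)) :=
          Nat.mul_le_mul_left _ ih
      _ = ((b + 1) * (s.card + 1)) * ∏ p ∈ s, (p - 1) := by ring
      _ ≤ ((s.card + 1 + 1) * b) * ∏ p ∈ s, (p - 1) := by
          apply Nat.mul_le_mul_right
          nlinarith
      _ = _ := by ring

lemma Nat.card_primeFactors_le_log {n : ℕ} (hn : n ≠ 0) : n.primeFactors.card ≤ Nat.log 2 n := by
  apply Nat.le_log_of_pow_le (by norm_num)
  calc 2 ^ n.primeFactors.card ≤ ∏ p ∈ n.primeFactors, p :=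
        Finset.pow_card_le_prod _ _ _ fun p hp => (Nat.prime_of_mem_primeFactors hp).two_le
    _ ≤ n := Nat.le_of_dvd (Nat.pos_of_ne_zero hn) (Nat.prod_primeFactors_dvd n)

lemma Nat.le_totient_mul_log (n : ℕ) : n ≤ n.totient * (Nat.log 2 n + 1) := by
  rcases eq_or_ne n 0 with rfl | hn
  · simp
  have h1 := Nat.totient_mul_prod_primeFactors n
  have h2 := Finset.prod_le_card_succ_mul_prod_pred n.primeFactors
    fun p hp => (Nat.prime_of_mem_primeFactors hp).two_le
  have hpos : 0 < ∏ p ∈ n.primeFactors, (p - 1) :=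
    Finset.prod_pos fun p hp => by have := (Nat.prime_of_mem_primeFactors hp).two_le; omega
  refine Nat.le_of_mul_le_mul_right ?_ hpos
  rw [← h1]
  calc n.totient * ∏ p ∈ n.primeFactors, p
      ≤ n.totient * ((n.primeFactors.card + 1) * ∏ p ∈ n.primeFactors, (p - 1)) :=
        Nat.mul_le_mul_left _ h2
    _ ≤ n.totient * ((Nat.log 2 n + 1) * ∏ p ∈ n.primeFactors, (p - 1)) := by
        gcongr; exact Nat.card_primeFactors_le_log hn
    _ = _ := by ring

/-! ### Counting field endomorphisms, primitive elements and nonsplit traces -/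

section FiniteField

variable (F : Type u) [Field F] [Finite F]

lemma finite_and_card_ringEnd_le : Finite (F →+* F) ∧ Nat.card (F →+* F) ≤ Nat.log 2 (Nat.card F) := by
  obtain ⟨p, hp⟩ := CharP.exists F
  have hprime : Fact p.Prime := ⟨CharP.char_is_prime F p⟩
  let _ := ZMod.algebra F p
  have hinj : Function.Injective (fun φ : F →+* F =>
      (⟨φ, fun r => congrArg (fun f : ZMod p →+* F => f r)
        (Subsingleton.elim (φ.comp (algebraMap (ZMod p) F)) (algebraMap (ZMod p) F))⟩ :
        F →ₐ[ZMod p] F)) := fun φ ψ h => by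
    ext x
    exact congrArg (fun f : F →ₐ[ZMod p] F => f x) h
  refine ⟨Finite.of_injective _ hinj, ?_⟩
  refine (Nat.card_le_card_of_injective _ hinj).trans ((card_algHom_le_finrank _ _ _).trans ?_)
  apply Nat.le_log_of_pow_le (by norm_num)
  rw [← FiniteField.pow_finrank_eq_natCard p F]
  exact Nat.pow_le_pow_left hprime.out.two_le _

lemma card_generators : Nat.card {l : Fˣ // ∀ s, s ∈ Subgroup.zpowers l} =
    (Nat.card F - 1).totient := by
  classical
  have := Fintype.ofFinite Fˣ
  rw [← Nat.card_units F, Nat.card_eq_fintype_card (α := Fˣ), ← IsCyclic.card_orderOf_eq_totient (α := Fˣ) dvd_rfl,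
    Nat.card_eq_fintype_card, Fintype.card_subtype]
  congr 1
  ext l
  simp only [Finset.mem_filter, Finset.mem_univ, true_and]
  rw [← Nat.card_eq_fintype_card]
  exact ⟨orderOf_eq_card_of_forall_mem_zpowers, fun h s => by
    rw [((Subgroup.zpowers l).card_eq_iff_eq_top).1 (by rw [Nat.card_zpowers, h])]; trivial⟩

/-- A split trace is `u + u⁻¹`, and `u ↦ u + u⁻¹` is at least two-to-one off `u = u⁻¹`; the constant
covers the traces `0`, `2` and `-2`. -/
lemma card_le_card_nonsplit :
    Nat.card F ≤ 2 * Nat.card {t : F // SL2.Nonsplit t ∧ t ≠ 0} + 6 := by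
  classical
  have := Fintype.ofFinite F
  have := Fintype.ofFinite Fˣ
  let f : Fˣ → F := fun u => u + (u : F)⁻¹
  let s : Finset Fˣ := Finset.univ.filter fun u => u⁻¹ ≠ u
  have h1 : 2 * (s.image f).card ≤ s.card := by
    apply Finset.mul_card_image_le_card
    intro t ht
    obtain ⟨u, hu, rfl⟩ := Finset.mem_image.1 ht
    have hu' : u⁻¹ ≠ u := (Finset.mem_filter.1 hu).2
    rw [← Finset.card_pair hu']
    apply Finset.card_le_card
    intro v hv
    rcases Finset.mem_insert.1 hv with rfl | hv
    · simp only [Finset.mem_filter, s, Finset.mem_univ, true_and, f, inv_inv, Units.val_inv_eq_inv_val]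
      exact ⟨hu'.symm, add_comm _ _⟩
    · rw [Finset.mem_singleton.1 hv]
      exact Finset.mem_filter.2 ⟨hu, rfl⟩
  have h2 : s.card ≤ Nat.card F - 1 := by
    rw [← Nat.card_units F, Nat.card_eq_fintype_card]
    exact Finset.card_le_univ s
  have h3 : (Finset.univ : Finset F) ⊆ (Finset.univ.filter fun t : F => SL2.Nonsplit t ∧ t ≠ 0) ∪
      (s.image f ∪ {0, 2, -2}) := by
    intro t _
    by_contra hc
    simp only [Finset.mem_union, Finset.mem_filter, Finset.mem_univ, true_and, Finset.mem_insert,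
      Finset.mem_singleton, not_or, not_and, not_not] at hc
    obtain ⟨hn, hs, h0, h2, h2'⟩ := hc
    have hns : ¬SL2.Nonsplit t := fun h => h0 (hn h)
    rw [SL2.Nonsplit] at hns
    push Not at hns
    obtain ⟨l, hl⟩ := hns
    have hl0 : l ≠ 0 := by rintro rfl; simp at hl
    have ht : t = l + l⁻¹ := by field_simp; linear_combination -hl
    apply hs
    refine Finset.mem_image.2 ⟨Units.mk0 l hl0, Finset.mem_filter.2 ⟨Finset.mem_univ _, ?_⟩, ht.symm⟩
    intro h
    have hll : l⁻¹ = l := by simpa using congrArg Units.val h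
    have : l ^ 2 = 1 := by rw [pow_two]; nth_rw 1 [← hll]; exact inv_mul_cancel₀ hl0
    rcases sq_eq_one_iff.1 this with rfl | rfl
    · apply h2; rw [ht]; norm_num
    · apply h2'; rw [ht]; norm_num
  have h4 := Finset.card_le_card h3
  have h5 := Finset.card_union_le (Finset.univ.filter fun t : F => SL2.Nonsplit t ∧ t ≠ 0)
      (s.image f ∪ {0, 2, -2})
  have h6 := Finset.card_union_le (s.image f) {0, 2, -2}
  have h7 : ({0, 2, -2} : Finset F).card ≤ 3 := Finset.card_le_three
  rw [Finset.card_univ, ← Nat.card_eq_fintype_card] at h4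
  rw [Nat.card_eq_fintype_card (α := {t : F // SL2.Nonsplit t ∧ t ≠ 0}), Fintype.card_subtype]
  omega

end FiniteField

namespace SL2

variable {F : Type u} [Field F]

/-! ### A large family of invariably generating pairs -/

lemma diag_mul (s t : Fˣ) : diag (s * t) = diag s * diag t := by
  apply ext4 <;> simp [mul_comm]

lemma diag_zpow (s : Fˣ) (n : ℤ) : diag (s ^ n) = diag s ^ n :=
  map_zpow (MonoidHom.mk' diag diag_mul) s n

/-- Conjugate so that the first representative is `diag l`; its powers fill the torus. The other has
nonsplit trace, so its off-diagonal entries do not vanish and `eq_top_of_diag_mem` applies to the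
preimage in `SL₂`. -/
lemma invGen_diag_comp [Finite F] (hq : 16 ≤ Nat.card F) {l : Fˣ}
    (hl : ∀ s, s ∈ Subgroup.zpowers l) {t : F} (ht : Nonsplit t) (ht0 : t ≠ 0) :
    InvGen (ConjClasses.mk ((diag l : SL(2, F)) : PSL(2, F)))
      (ConjClasses.mk ((comp t : SL(2, F)) : PSL(2, F))) := by
  intro x y hx hy
  obtain ⟨k, hk⟩ := isConj_iff.1 (ConjClasses.mk_eq_mk_iff_isConj.1 hx)
  let K := (Subgroup.closure {x, y}).map (MulAut.conj k).toMonoidHom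
  let H := K.comap (QuotientGroup.mk' (Subgroup.center SL(2, F)))
  have hxK : ((diag l : SL(2, F)) : PSL(2, F)) ∈ K :=
    ⟨x, Subgroup.subset_closure (by simp), hk⟩
  have hd : ∀ s, diag s ∈ H := by
    intro s
    obtain ⟨n, rfl⟩ := Subgroup.mem_zpowers_iff.1 (hl s)
    rw [diag_zpow]
    exact H.zpow_mem hxK n
  obtain ⟨B, hB⟩ := QuotientGroup.mk_surjective (k * y * k⁻¹)
  have hBH : B ∈ H := by
    change ((B : SL(2, F)) : PSL(2, F)) ∈ K
    rw [hB]
    exact ⟨y, Subgroup.subset_closure (by simp), rfl⟩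
  have hBt : tr B = t ∨ tr B = -t := by
    have : ConjClasses.mk (B : PSL(2, F)) = ConjClasses.mk ((comp t : SL(2, F)) : PSL(2, F)) := by
      rw [← hy, hB, ConjClasses.mk_eq_mk_iff_isConj]
      exact (isConj_iff.2 ⟨k, rfl⟩).symm
    simpa using tr_eq_or_of_mk_eq_mk this
  have hns : Nonsplit (tr B) ∧ tr B ≠ 0 := by
    rcases hBt with h | h <;> rw [h]
    · exact ⟨ht, ht0⟩
    · exact ⟨ht.neg, neg_ne_zero.2 ht0⟩
  have hH : H = ⊤ := eq_top_of_diag_mem hq hd hBH hns.1.entry_01_ne_zero hns.1.entry_10_ne_zero hns.2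
  rw [eq_top_iff]
  intro z _
  obtain ⟨Z, hZ⟩ := QuotientGroup.mk_surjective (k * z * k⁻¹)
  have hZH : Z ∈ H := by rw [hH]; trivial
  obtain ⟨z', hz', hzz⟩ : ((Z : SL(2, F)) : PSL(2, F)) ∈ K := hZH
  rw [hZ] at hzz
  rwa [← (MulAut.conj k).injective hzz]

variable (F) in
/-- Generators of the multiplicative group, paired with nonzero nonsplit traces. -/
abbrev GenericPair : Type u :=
  {l : Fˣ // ∀ s, s ∈ Subgroup.zpowers l} × {t : F // Nonsplit t ∧ t ≠ 0}

/-- The orbit of the pair of classes attached to a generator and a nonsplit trace. -/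
def GenericPair.orbit [Finite F] (hq : 16 ≤ Nat.card F) (p : GenericPair F) :
    InvGenOrbit PSL(2, F) :=
  InvGenPair.orbit ⟨(ConjClasses.mk ((diag p.1.1 : SL(2, F)) : PSL(2, F)),
    ConjClasses.mk ((comp p.2.1 : SL(2, F)) : PSL(2, F))), invGen_diag_comp hq p.1.2 p.2.2.1 p.2.2.2⟩

lemma sq_ne_one_of_generator [Finite F] (hq : 4 ≤ Nat.card F) {l : Fˣ}
    (hl : ∀ s, s ∈ Subgroup.zpowers l) : l ^ 2 ≠ 1 := by
  intro h
  obtain ⟨s, hs⟩ := exists_unit_sq_ne_one hq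
  obtain ⟨n, rfl⟩ := Subgroup.mem_zpowers_iff.1 (hl s)
  apply hs
  rw [← Units.val_pow_eq_pow_val, ← zpow_natCast, ← zpow_mul, mul_comm, zpow_mul, zpow_natCast, h,
    one_zpow, Units.val_one]

lemma eq_or_eq_inv_of_add_inv {x y : F} (hx : x ≠ 0) (hy : y ≠ 0) (h : x + x⁻¹ = y + y⁻¹) :
    x = y ∨ x = y⁻¹ := by
  have : (x - y) * (x - y⁻¹) = 0 := by
    field_simp at h ⊢
    linear_combination h
  rcases mul_eq_zero.1 this with h | h
  · exact Or.inl (sub_eq_zero.1 h)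
  · exact Or.inr (sub_eq_zero.1 h)

/-- A pair in the orbit is determined by a field endomorphism, a sign and an inversion for the
generator, and a sign for the nonsplit trace. This gives the factor `8`. -/
lemma card_fiber_orbit_le [Finite F] (hq : 16 ≤ Nat.card F) [Fintype (GenericPair F)]
    [DecidableEq (InvGenOrbit PSL(2, F))] (p : GenericPair F) :
    (Finset.univ.filter fun r : GenericPair F => r.orbit hq = p.orbit hq).card ≤
      8 * Nat.log 2 (Nat.card F) := by
  classical
  obtain ⟨hfin, hcard⟩ := finite_and_card_ringEnd_le F
  have := Fintype.ofFinite (F →+* F)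
  have : (Finset.univ.filter fun r : GenericPair F => r.orbit hq = p.orbit hq).card ≤
      (Finset.univ : Finset ((F →+* F) × Bool × Bool × Bool)).card := by
    let g : (F →+* F) × Bool × Bool × Bool → F × F := fun ⟨φ, a, b, c⟩ =>
      (bif a then (bif b then φ (p.1.1 : Fˣ) else (φ (p.1.1 : Fˣ))⁻¹)
        else -(bif b then φ (p.1.1 : Fˣ) else (φ (p.1.1 : Fˣ))⁻¹),
        bif c then φ p.2.1 else -φ p.2.1)
    let v : GenericPair F → F × F := fun r => ((r.1.1 : Fˣ), r.2.1)
    have hv : Function.Injective v := by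
      rintro ⟨⟨l, hl⟩, ⟨t, ht⟩⟩ ⟨⟨l', hl'⟩, ⟨t', ht'⟩⟩ h
      obtain ⟨h1, h2⟩ := Prod.ext_iff.1 h
      have h1' : l = l' := Units.ext h1
      have h2' : t = t' := h2
      subst h1' h2'
      rfl
    rw [← Finset.card_image_of_injective _ hv]
    refine (Finset.card_le_card ?_).trans (Finset.card_image_le (f := g))
    intro w hw
    obtain ⟨r, hr, rfl⟩ := Finset.mem_image.1 hw
    have hr := (Finset.mem_filter.1 hr).2
    obtain ⟨α, h1, h2⟩ := InvGenPair.orbit_eq_iff.1 hr.symm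
    obtain ⟨φ, hφ⟩ := exists_ringHom_tr α
    have hl1 : ((p.1.1 : Fˣ) : F) ≠ 0 := Units.ne_zero _
    have hl2 : ((r.1.1 : Fˣ) : F) ≠ 0 := Units.ne_zero _
    have hsq : ((p.1.1 : Fˣ) : F) ^ 2 ≠ 1 := by
      intro h
      apply sq_ne_one_of_generator (by omega) p.1.2
      apply Units.ext
      simpa using h
    have e1 := hφ _ _ (by
      rw [tr_diag]
      intro h
      apply hsq
      have : ((p.1.1 : Fˣ) : F) - 1 = 0 := by
        apply pow_eq_zero_iff (two_ne_zero) |>.1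
        field_simp at h
        linear_combination h
      rw [sub_eq_zero.1 this]; ring) (by
      rw [tr_diag]
      intro h
      apply hsq
      have : ((p.1.1 : Fˣ) : F) + 1 = 0 := by
        apply pow_eq_zero_iff (two_ne_zero) |>.1
        field_simp at h
        linear_combination h
      rw [eq_neg_of_add_eq_zero_left this]; ring) h1
    have e2 := hφ _ _ (by rw [tr_comp]; exact p.2.2.1.ne_two)
      (by rw [tr_comp]; exact p.2.2.1.ne_neg_two) h2
    rw [tr_diag, tr_diag, map_add, map_inv₀] at e1
    rw [tr_comp, tr_comp] at e2
    have hφ0 : φ ((p.1.1 : Fˣ) : F) ≠ 0 := (map_ne_zero φ).2 hl1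
    have f1 : ∃ a b : Bool, ((r.1.1 : Fˣ) : F) =
        bif a then (bif b then φ (p.1.1 : Fˣ) else (φ (p.1.1 : Fˣ))⁻¹)
        else -(bif b then φ (p.1.1 : Fˣ) else (φ (p.1.1 : Fˣ))⁻¹) := by
      rcases e1 with e1 | e1
      · rcases eq_or_eq_inv_of_add_inv hl2 hφ0 e1 with h | h
        · exact ⟨true, true, h⟩
        · exact ⟨true, false, h⟩
      · have e1' : -((r.1.1 : Fˣ) : F) + (-((r.1.1 : Fˣ) : F))⁻¹ = φ ((p.1.1 : Fˣ) : F) +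
            (φ ((p.1.1 : Fˣ) : F))⁻¹ := by rw [inv_neg, ← neg_add, e1, neg_neg]
        rcases eq_or_eq_inv_of_add_inv (neg_ne_zero.2 hl2) hφ0 e1' with h | h
        · exact ⟨false, true, neg_eq_iff_eq_neg.1 h⟩
        · exact ⟨false, false, neg_eq_iff_eq_neg.1 h⟩
    have f2 : ∃ c : Bool, r.2.1 = bif c then φ p.2.1 else -φ p.2.1 := by
      rcases e2 with e2 | e2
      · exact ⟨true, e2⟩
      · exact ⟨false, e2⟩
    obtain ⟨a, b, f1⟩ := f1
    obtain ⟨c, f2⟩ := f2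
    exact Finset.mem_image.2 ⟨(φ, a, b, c), Finset.mem_univ _, Prod.ext f1.symm f2.symm⟩
  refine this.trans ?_
  rw [Finset.card_univ]
  simp only [Fintype.card_prod, Fintype.card_bool]
  rw [Nat.card_eq_fintype_card] at hcard
  omega

/-- There are at least `q² / log² q` orbits of invariably generating pairs, up to a constant. -/
theorem sq_le_card_invGenOrbit [Finite F] (hq : 16 ≤ Nat.card F) :
    Nat.card F ^ 2 ≤ 128 * Nat.card (InvGenOrbit PSL(2, F)) * (Nat.log 2 (Nat.card F) + 1) ^ 2 := by
  classical
  have := Fintype.ofFinite (GenericPair F)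
  have := Fintype.ofFinite (InvGenOrbit PSL(2, F))
  have h1 : Nat.card (GenericPair F) ≤
      8 * Nat.log 2 (Nat.card F) * Nat.card (InvGenOrbit PSL(2, F)) := by
    rw [Nat.card_eq_fintype_card (α := GenericPair F), ← Finset.card_univ,
      Nat.card_eq_fintype_card (α := InvGenOrbit PSL(2, F))]
    refine (Finset.card_le_mul_card_image (f := fun p : GenericPair F => p.orbit hq) Finset.univ
      (8 * Nat.log 2 (Nat.card F)) ?_).trans (Nat.mul_le_mul_left _ (Finset.card_le_univ _))
    intro o ho
    obtain ⟨p, _, rfl⟩ := Finset.mem_image.1 ho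
    exact card_fiber_orbit_le hq p
  rw [Nat.card_prod, card_generators] at h1
  have h2 := Nat.le_totient_mul_log (Nat.card F - 1)
  have h3 := card_le_card_nonsplit F
  have h4 : Nat.log 2 (Nat.card F - 1) ≤ Nat.log 2 (Nat.card F) := Nat.log_mono_right (by omega)
  generalize Nat.log 2 (Nat.card F) = L at *
  generalize Nat.log 2 (Nat.card F - 1) = L' at *
  generalize (Nat.card F - 1).totient = T at *
  generalize Nat.card {t : F // Nonsplit t ∧ t ≠ 0} = N at *
  generalize Nat.card (InvGenOrbit PSL(2, F)) = b at *
  generalize Nat.card F = q at *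
  have h5 : q ≤ 2 * (T * (L + 1)) := by
    have : T * (L' + 1) ≤ T * (L + 1) := Nat.mul_le_mul_left _ (by omega)
    omega
  have h6 : q ≤ 8 * N := by omega
  calc q ^ 2 = q * q := by ring
    _ ≤ (2 * (T * (L + 1))) * (8 * N) := Nat.mul_le_mul h5 h6
    _ = 16 * (L + 1) * (T * N) := by ring
    _ ≤ 16 * (L + 1) * (8 * L * b) := Nat.mul_le_mul_left _ h1
    _ ≤ 16 * (L + 1) * (8 * (L + 1) * b) := by gcongr; omega
    _ = _ := by ring

end SL2

namespace SL2

variable {F : Type u} [Field F]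

/-! ### Upper bound for the number of invariably generating pairs -/

lemma isConj_upper_sq_mul {s : F} (hs : s ≠ 0) (x : F) : IsConj (upper x) (upper (s ^ 2 * x)) :=
  isConj_iff.2 ⟨diag (Units.mk0 s hs), diag_conj_upper _ _⟩

variable (F) in
lemma exists_forall_isSquare_mul [Finite F] :
    ∃ n : F, n ≠ 0 ∧ ∀ x : F, x ≠ 0 → IsSquare x ∨ IsSquare (n * x) := by
  by_cases h : ∀ x : F, IsSquare x
  · exact ⟨1, one_ne_zero, fun x _ => Or.inl (h x)⟩
  · push Not at h
    obtain ⟨n, hn⟩ := h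
    have hn0 : n ≠ 0 := by rintro rfl; exact hn (IsSquare.zero)
    exact ⟨n, hn0, fun x hx => or_iff_not_imp_left.2 fun hxs =>
      isSquare_mul_of_iff hn0 hx ⟨fun h => absurd h hn, fun h => absurd h hxs⟩⟩

-- Besides the `q` companion classes there are at most three classes of trace `±2`, represented by
-- `upper 0`, `upper 1` and `upper n` with `n` covering the other square class.
variable (F) in
lemma card_conjClasses_le [Finite F] : Nat.card (ConjClasses PSL(2, F)) ≤ Nat.card F + 3 := by
  obtain ⟨n, hn0, hn⟩ := exists_forall_isSquare_mul F
  let u : Option Bool → F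
    | none => 0
    | some true => 1
    | some false => n
  let f : F ⊕ Option Bool → ConjClasses PSL(2, F) :=
    Sum.elim (fun t => ConjClasses.mk ((comp t : SL(2, F)) : PSL(2, F)))
      (fun o => ConjClasses.mk ((upper (u o) : SL(2, F)) : PSL(2, F)))
  have hf : Function.Surjective f := by
    intro C
    obtain ⟨A, rfl⟩ := exists_lift C
    by_cases h : tr A = 2 ∨ tr A = -2
    · obtain ⟨x, hx⟩ := exists_conj_upper h
      have key : ∃ o, ∃ s : F, s ≠ 0 ∧ s ^ 2 * u o = x := by
        by_cases hx0 : x = 0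
        · exact ⟨none, 1, one_ne_zero, by simp [u, hx0]⟩
        rcases hn x hx0 with ⟨s, hs⟩ | ⟨s, hs⟩
        · refine ⟨some true, s, ?_, ?_⟩
          · rintro rfl; simp at hs; exact hx0 hs
          · simp [u, hs]; ring
        · refine ⟨some false, s / n, div_ne_zero ?_ hn0, ?_⟩
          · rintro rfl; simp [hn0, hx0] at hs
          · simp only [u]; field_simp; rw [hs]; ring
      obtain ⟨o, s, hs, hso⟩ := key
      refine ⟨Sum.inr o, ?_⟩
      change ConjClasses.mk ((upper (u o) : SL(2, F)) : PSL(2, F)) = _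
      rw [ConjClasses.mk_eq_mk_iff_isConj]
      refine IsConj.trans (isConj_mk (isConj_upper_sq_mul hs (u o))) ?_
      rwa [hso]
    · rw [not_or] at h
      exact ⟨Sum.inl (tr A), mk_comp_eq_mk h.1 h.2 rfl⟩
  have := Nat.card_le_card_of_surjective f hf
  rw [Nat.card_sum, Nat.card_eq_fintype_card (α := Option Bool)] at this
  simpa using this

variable (F) in
/-- At most half of all ordered pairs of classes are invariably generating. -/
lemma two_mul_card_invGenPair_le [Finite F] :
    2 * Nat.card (InvGenPair PSL(2, F)) ≤ (Nat.card F + 3) ^ 2 := by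
  classical
  let f : InvGenPair PSL(2, F) →
      ({C : ConjClasses PSL(2, F) // IsNonsplitClass C} ×
        {C : ConjClasses PSL(2, F) // ¬IsNonsplitClass C}) × Bool := fun p =>
    if h : IsNonsplitClass p.1.1 then
      ((⟨p.1.1, h⟩, ⟨p.1.2, fun h' => p.2.isNonsplitClass_iff.1 h h'⟩), true)
    else ((⟨p.1.2, p.2.symm.isNonsplitClass_iff.2 h⟩, ⟨p.1.1, h⟩), false)
  have hf : Function.Injective f := by
    intro p r h
    by_cases hp : IsNonsplitClass p.1.1 <;> by_cases hr : IsNonsplitClass r.1.1 <;>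
      simp only [f, hp, hr, dif_pos, dif_neg, not_false_eq_true, Prod.mk.injEq, Subtype.mk.injEq,
        and_true, and_false, reduceCtorEq] at h
    · exact Subtype.ext (Prod.ext h.1 h.2)
    · exact Subtype.ext (Prod.ext h.2 h.1)
  have h1 := Nat.card_le_card_of_injective f hf
  rw [Nat.card_prod, Nat.card_prod] at h1
  have h2 := Nat.card_congr (Equiv.sumCompl (fun C : ConjClasses PSL(2, F) => IsNonsplitClass C))
  rw [Nat.card_sum] at h2
  have h3 := card_conjClasses_le F
  rw [← h2] at h3
  generalize Nat.card {C : ConjClasses PSL(2, F) // IsNonsplitClass C} = a at *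
  generalize Nat.card {C : ConjClasses PSL(2, F) // ¬IsNonsplitClass C} = b at *
  rw [Nat.card_eq_fintype_card (α := Bool), Fintype.card_bool] at h1
  calc 2 * Nat.card (InvGenPair PSL(2, F)) ≤ 2 * (a * b * 2) := Nat.mul_le_mul_left _ h1
    -- AM-GM: `4ab ≤ (a + b)²`, with `a` nonsplit and `b` split classes.
    _ ≤ (a + b) ^ 2 := by zify; nlinarith [sq_nonneg ((a : ℤ) - b)]
    _ ≤ _ := Nat.pow_le_pow_left h3 2

variable (F) in
lemma two_mul_card_invGenOrbit_le [Finite F] :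
    2 * Nat.card (InvGenOrbit PSL(2, F)) ≤ (Nat.card F + 3) ^ 2 :=
  (Nat.mul_le_mul_left 2 (Nat.card_le_card_of_surjective InvGenPair.orbit
    InvGenPair.exists_orbit)).trans (two_mul_card_invGenPair_le F)

/-! ### Automorphisms preserve the type of a class -/

lemma Nonsplit.map [Finite F] (φ : F →+* F) {t : F} (h : Nonsplit t) : Nonsplit (φ t) := by
  intro l hl
  obtain ⟨m, rfl⟩ := Finite.surjective_of_injective φ.injective l
  apply h m
  apply φ.injective
  rw [map_add, map_sub, map_mul, map_pow, map_one, map_zero, hl]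

lemma IsNonsplitClass.map [Finite F] {C : ConjClasses PSL(2, F)} (h : IsNonsplitClass C)
    (α : PSL(2, F) ≃* PSL(2, F)) : IsNonsplitClass (C.map α.toMonoidHom) := by
  obtain ⟨A, rfl, hA⟩ := h
  obtain ⟨φ, hφ⟩ := exists_ringHom_tr α
  obtain ⟨B, hB⟩ := exists_lift ((ConjClasses.mk (A : PSL(2, F))).map α.toMonoidHom)
  rw [← hB, isNonsplitClass_mk]
  rcases hφ A B hA.ne_two hA.ne_neg_two hB.symm with e | e <;> rw [e]
  · exact hA.map φ
  · exact (hA.map φ).neg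

lemma isNonsplitClass_iff_of_orbit_eq [Finite F] {p r : InvGenPair PSL(2, F)}
    (h : p.orbit = r.orbit) : IsNonsplitClass p.1.1 ↔ IsNonsplitClass r.1.1 := by
  have key : ∀ p r : InvGenPair PSL(2, F), p.orbit = r.orbit → IsNonsplitClass p.1.1 →
      IsNonsplitClass r.1.1 := by
    intro p r h hp
    obtain ⟨α, h1, -⟩ := InvGenPair.orbit_eq_iff.1 h
    rw [← h1]
    exact hp.map α
  exact ⟨key p r h, key r p h.symm⟩

end SL2

section Swap

variable {G : Type u} [Group G]

/-- The pair with its two classes exchanged. -/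
def InvGenPair.swap (p : InvGenPair G) : InvGenPair G := ⟨(p.1.2, p.1.1), p.2.symm⟩

lemma InvGenPair.orbit_swap {p r : InvGenPair G} (h : p.orbit = r.orbit) :
    p.swap.orbit = r.swap.orbit := by
  obtain ⟨α, h1, h2⟩ := InvGenPair.orbit_eq_iff.1 h
  exact InvGenPair.orbit_eq_iff.2 ⟨α, h2, h1⟩

end Swap

namespace SL2

variable {F : Type u} [Field F]

/-! ### Connected components -/

variable (F) in
/-- The orbits whose first class is nonsplit. -/
def NonsplitOrbit : Type u :=
  {o : InvGenOrbit PSL(2, F) // ∃ p : InvGenPair PSL(2, F), p.orbit = o ∧ IsNonsplitClass p.1.1}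

instance [Finite F] : Finite (NonsplitOrbit F) := Subtype.finite

/-- A representative of the orbit. -/
noncomputable def NonsplitOrbit.rep (o : NonsplitOrbit F) : InvGenPair PSL(2, F) := o.2.choose

lemma NonsplitOrbit.orbit_rep (o : NonsplitOrbit F) : o.rep.orbit = o.1 := o.2.choose_spec.1

lemma NonsplitOrbit.isNonsplitClass_rep (o : NonsplitOrbit F) : IsNonsplitClass o.rep.1.1 :=
  o.2.choose_spec.2

/-- The representative of an orbit, or its swap. -/
noncomputable def orientedPair (k : NonsplitOrbit F × Bool) : InvGenPair PSL(2, F) :=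
  bif k.2 then k.1.rep else k.1.rep.swap

lemma isNonsplitClass_orientedPair [Finite F] (k : NonsplitOrbit F × Bool) :
    IsNonsplitClass (orientedPair k).1.1 ↔ k.2 = true := by
  rcases k with ⟨o, _ | _⟩
  · have h : ¬IsNonsplitClass (orientedPair (o, false)).1.1 := fun h =>
      o.rep.2.isNonsplitClass_iff.1 o.isNonsplitClass_rep h
    simpa using h
  · have h : IsNonsplitClass (orientedPair (o, true)).1.1 := o.isNonsplitClass_rep
    simpa using h

/-- Automorphisms preserve nonsplitness and exactly one class of a pair is nonsplit, so swapping
never fixes an orbit, and each orbit has a definite orientation. -/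
lemma orbit_orientedPair_bijective [Finite F] :
    Function.Bijective fun k : NonsplitOrbit F × Bool => (orientedPair k).orbit := by
  constructor
  · rintro ⟨o, c⟩ ⟨o', c'⟩ h
    have hc := isNonsplitClass_iff_of_orbit_eq h
    rw [isNonsplitClass_orientedPair, isNonsplitClass_orientedPair] at hc
    have hcc : c = c' := Bool.eq_iff_iff.2 hc
    subst hcc
    have ho : o.rep.orbit = o'.rep.orbit := by
      cases c
      · exact InvGenPair.orbit_swap h
      · exact h
    rw [o.orbit_rep, o'.orbit_rep] at ho
    rw [Subtype.ext ho]
  · intro o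
    obtain ⟨p, rfl⟩ := InvGenPair.exists_orbit o
    by_cases hp : IsNonsplitClass p.1.1
    · exact ⟨(⟨p.orbit, p, rfl, hp⟩, true), NonsplitOrbit.orbit_rep ⟨p.orbit, p, rfl, hp⟩⟩
    · have hs : IsNonsplitClass p.swap.1.1 := p.2.symm.isNonsplitClass_iff.2 hp
      exact ⟨(⟨p.swap.orbit, p.swap, rfl, hs⟩, false),
        InvGenPair.orbit_swap (NonsplitOrbit.orbit_rep ⟨p.swap.orbit, p.swap, rfl, hs⟩)⟩

variable (F) in
lemma card_invGenOrbit_eq [Finite F] : Nat.card (InvGenOrbit PSL(2, F)) = 2 * Nat.card (NonsplitOrbit F) := by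
  rw [← Nat.card_congr (Equiv.ofBijective _ (orbit_orientedPair_bijective (F := F))), Nat.card_prod,
    Nat.card_eq_fintype_card (α := Bool), Fintype.card_bool, mul_comm]

/-- The `i`-th component of a class of a power. -/
def component {t : ℕ} (C : ConjClasses (Fin t → PSL(2, F))) (i : Fin t) : ConjClasses PSL(2, F) :=
  C.map (Pi.evalMonoidHom (fun _ : Fin t => PSL(2, F)) i)

lemma component_invGen [IsSimpleGroup PSL(2, F)] {t : ℕ} {C D : ConjClasses (Fin t → PSL(2, F))}
    (h : InvGen C D) (i : Fin t) : InvGen (component C i) (component D i) := by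
  obtain ⟨x, rfl⟩ := ConjClasses.exists_rep C
  obtain ⟨y, rfl⟩ := ConjClasses.exists_rep D
  exact ((invGen_pi_iff (exists_mul_ne_mul F) x y).1 h).1 i

/-- Each edge flips the type in every coordinate, so the parity of the length of a walk decides
which alternative holds. -/
lemma type_eq_or_of_reachable [Finite F] [IsSimpleGroup PSL(2, F)] {t : ℕ}
    {C D : (invGenGraph (Fin t → PSL(2, F))).support}
    (h : (invGenGraphPlus (Fin t → PSL(2, F))).Reachable C D) :
    (∀ i, IsNonsplitClass (component C.1.1 i) ↔ IsNonsplitClass (component D.1.1 i)) ∨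
      ∀ i, IsNonsplitClass (component C.1.1 i) ↔ ¬IsNonsplitClass (component D.1.1 i) := by
  obtain ⟨w⟩ := h
  induction w with
  | nil => exact Or.inl fun i => Iff.rfl
  | cons hadj _ ih =>
    have hg := invariablyGenerates_pair_iff.1 hadj.2
    have e := fun i => (component_invGen hg i).isNonsplitClass_iff
    rcases ih with ih | ih
    · exact Or.inr fun i => (e i).trans (not_congr (ih i))
    · exact Or.inl fun i => (e i).trans ((not_congr (ih i)).trans not_not)

variable (F) in
/-- Reversing an arbitrary subset of the coordinates produces many components. -/
theorem two_pow_le_two_mul_numComponents [Finite F] (hq : 4 ≤ Nat.card F)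
    (hpos : 0 < Nat.card (NonsplitOrbit F)) :
    2 ^ Nat.card (NonsplitOrbit F) ≤ 2 * numComponents PSL(2, F) := by
  classical
  have := Matrix.ProjectiveSpecialLinearGroup.rank_two_simple hq
  have hcomm := exists_mul_ne_mul F
  have hβ : invBeta PSL(2, F) = Nat.card (NonsplitOrbit F × Bool) := by
    rw [invBeta_eq hcomm, card_invGenOrbit_eq, Nat.card_prod, Nat.card_eq_fintype_card (α := Bool),
      Fintype.card_bool, mul_comm]
  rw [numComponents]
  generalize hb : invBeta PSL(2, F) = β at *
  let e : Fin β ≃ NonsplitOrbit F × Bool :=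
    (finCongr hβ).trans (Finite.equivFin (NonsplitOrbit F × Bool)).symm
  have hcomm' : ∃ a b : Fin β → PSL(2, F), a * b ≠ b * a := by
    obtain ⟨a, b, hab⟩ := hcomm
    have hβ0 : 0 < β := by
      rw [hβ, Nat.card_prod, Nat.card_eq_fintype_card (α := Bool), Fintype.card_bool]; omega
    exact ⟨fun _ => a, fun _ => b, fun h => hab (congrFun h ⟨0, hβ0⟩)⟩
  -- Both orientations of every orbit occur among the coordinates, so reversing those selected by
  -- `σ` merely permutes the orbits and keeps them distinct.
  let P : (NonsplitOrbit F → Bool) → Fin β → InvGenPair PSL(2, F) := fun σ i =>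
    orientedPair ((e i).1, xor (e i).2 (σ (e i).1))
  choose x hx using fun σ i => ConjClasses.exists_rep (P σ i).1.1
  choose y hy using fun σ i => ConjClasses.exists_rep (P σ i).1.2
  have hg : ∀ σ i, InvGen (ConjClasses.mk (x σ i)) (ConjClasses.mk (y σ i)) := fun σ i => by
    rw [hx, hy]; exact (P σ i).2
  have hgen : ∀ σ, InvGen (ConjClasses.mk (x σ)) (ConjClasses.mk (y σ)) := by
    intro σ
    apply invGen_pi_of_injective hcomm (x σ) (y σ) (hg σ)
    intro i j hij
    have hP : ∀ i, (⟨(ConjClasses.mk (x σ i), ConjClasses.mk (y σ i)), hg σ i⟩ :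
        InvGenPair PSL(2, F)) = P σ i := fun i => Subtype.ext (Prod.ext (hx σ i) (hy σ i))
    simp only [hP] at hij
    have := orbit_orientedPair_bijective.1 hij
    obtain ⟨h1, h2⟩ := Prod.ext_iff.1 this
    simp only at h1 h2
    rw [h1] at h2
    exact e.injective (Prod.ext h1 (Bool.xor_left_inj.1 h2))
  let V : (NonsplitOrbit F → Bool) → (invGenGraph (Fin β → PSL(2, F))).support := fun σ =>
    ⟨⟨ConjClasses.mk (x σ), (hgen σ).ne_one hcomm'⟩,
      ⟨⟨ConjClasses.mk (y σ), (hgen σ).symm.ne_one hcomm'⟩,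
        fun h => (hgen σ).ne hcomm' (congrArg Subtype.val h),
        invariablyGenerates_pair_iff.2 (hgen σ)⟩⟩
  have htype : ∀ σ o, IsNonsplitClass (component (V σ).1.1 (e.symm (o, true))) ↔ σ o = false := by
    intro σ o
    change IsNonsplitClass (ConjClasses.mk (x σ (e.symm (o, true)))) ↔ _
    rw [hx, isNonsplitClass_orientedPair]
    simp
  have := Fintype.ofFinite (NonsplitOrbit F)
  have := Fintype.ofFinite (invGenGraphPlus (Fin β → PSL(2, F))).ConnectedComponent
  let c : (NonsplitOrbit F → Bool) → (invGenGraphPlus (Fin β → PSL(2, F))).ConnectedComponent :=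
    fun σ => (invGenGraphPlus (Fin β → PSL(2, F))).connectedComponentMk (V σ)
  have hfib : (Finset.univ : Finset (NonsplitOrbit F → Bool)).card ≤ 2 * (Finset.univ.image c).card := by
    apply Finset.card_le_mul_card_image
    intro d hd
    obtain ⟨σ, _, rfl⟩ := Finset.mem_image.1 hd
    -- The type vector at the coordinates `(o, true)` recovers `σ`, so only `σ` and its complement
    -- can share a component.
    refine (Finset.card_le_card (t := {σ, fun o => !σ o}) ?_).trans Finset.card_le_two
    intro τ hτ
    have hr := SimpleGraph.ConnectedComponent.exact (Finset.mem_filter.1 hτ).2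
    rw [Finset.mem_insert, Finset.mem_singleton]
    rcases type_eq_or_of_reachable hr with h | h
    · left; funext o
      have := h (e.symm (o, true))
      rw [htype, htype] at this
      cases h1 : τ o <;> cases h2 : σ o <;> simp_all
    · right; funext o
      have := h (e.symm (o, true))
      rw [htype, htype] at this
      cases h1 : τ o <;> cases h2 : σ o <;> simp_all
  rw [Finset.card_univ, Fintype.card_fun, Fintype.card_bool, ← Nat.card_eq_fintype_card] at hfib
  refine hfib.trans (Nat.mul_le_mul_left 2 ?_)
  rw [Nat.card_eq_fintype_card]
  exact Finset.card_le_univ _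

end SL2

/-! ### Asymptotics -/

/-- The exponent loss `log (8192 log² q) / log q`. -/
noncomputable def exponentLoss (n : ℕ) : ℝ :=
  Real.log (8192 * Real.log n ^ 2) / Real.log n

lemma tendsto_exponentLoss : Tendsto exponentLoss atTop (𝓝 0) := by
  have h1 : Tendsto (fun x : ℝ => Real.log 8192 / x + 2 * (Real.log x / x)) atTop (𝓝 (0 + 2 * 0)) :=
    (tendsto_const_nhds.div_atTop tendsto_id).add
      (Real.isLittleO_log_id_atTop.tendsto_div_nhds_zero.const_mul 2)
  have h2 : Tendsto (fun x : ℝ => Real.log (8192 * x ^ 2) / x) atTop (𝓝 0) := by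
    rw [mul_zero, add_zero] at h1
    refine h1.congr' ?_
    filter_upwards [eventually_gt_atTop 0] with x hx
    rw [Real.log_mul (by norm_num) (by positivity), Real.log_pow]
    push_cast
    ring
  exact h2.comp (Real.tendsto_log_atTop.comp tendsto_natCast_atTop_atTop)

lemma natLog_two_add_one_le {n : ℕ} (hn : 2 ≤ n) : (Nat.log 2 n + 1 : ℝ) ≤ 4 * Real.log n := by
  have h2 : 0.6931471803 < Real.log 2 := Real.log_two_gt_d9
  have h1 : (Nat.log 2 n : ℝ) * Real.log 2 ≤ Real.log n := by
    rw [← Real.log_pow]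
    apply Real.log_le_log (by positivity)
    exact_mod_cast Nat.pow_log_le_self 2 (by omega)
  have h3 : Real.log 2 ≤ Real.log n := Real.log_le_log (by norm_num) (by exact_mod_cast hn)
  nlinarith [(Nat.log 2 n).cast_nonneg (α := ℝ)]

lemma rpow_two_sub_exponentLoss {n : ℕ} (hn : 2 ≤ n) :
    (n : ℝ) ^ (2 - exponentLoss n) = n ^ 2 / (8192 * Real.log n ^ 2) := by
  have hn' : (0 : ℝ) < n := by positivity
  have hlog : 0 < Real.log n := Real.log_pos (by exact_mod_cast hn)
  rw [Real.rpow_sub hn', Real.rpow_ofNat]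
  congr 1
  rw [Real.rpow_def_of_pos hn', exponentLoss, mul_div_cancel₀ _ hlog.ne', Real.exp_log (by positivity)]

/-- A quantity `b` with `q² ≤ C b log² q` exceeds a power of `q` with exponent close to `2`. -/
lemma rpow_le_half_sub_one : ∃ q₀ : ℕ, 16 ≤ q₀ ∧ ∀ q b : ℕ, q₀ ≤ q →
    q ^ 2 ≤ 128 * b * (Nat.log 2 q + 1) ^ 2 →
    (q : ℝ) ^ (2 - exponentLoss q) ≤ b / 2 - 1 := by
  obtain ⟨q₁, hq₁⟩ := eventually_atTop.1 (tendsto_exponentLoss.eventually_le_const zero_lt_one)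
  refine ⟨max q₁ 16, le_max_right _ _, fun q b hq h => ?_⟩
  have hq16 : 16 ≤ q := (le_max_right _ _).trans hq
  have hε := hq₁ q ((le_max_left _ _).trans hq)
  have hlog : 0 < Real.log q := Real.log_pos (by exact_mod_cast (by omega : 1 < q))
  have hL := natLog_two_add_one_le (n := q) (by omega)
  have h' : (q : ℝ) ^ 2 ≤ 128 * b * (Nat.log 2 q + 1) ^ 2 := by exact_mod_cast h
  have h1 : (q : ℝ) ^ (2 - exponentLoss q) ≤ b / 4 := by
    rw [rpow_two_sub_exponentLoss (by omega), div_le_iff₀ (by positivity)]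
    calc (q : ℝ) ^ 2 ≤ 128 * b * (Nat.log 2 q + 1) ^ 2 := h'
      _ ≤ 128 * b * (4 * Real.log q) ^ 2 := by gcongr
      _ = _ := by ring
  have h2 : (1 : ℝ) ≤ (q : ℝ) ^ (2 - exponentLoss q) := by
    apply Real.one_le_rpow
    · exact_mod_cast (by omega : 1 ≤ q)
    · linarith
  linarith

theorem theorem2p8 :
    -- `β(PSL₂(q))` really is the largest such integer
    (∀ (F : Type u) [Field F] [Finite F], 4 ≤ Nat.card F →
      IsGreatest (invTwoGenPowers PSL(2, F)) (invBeta PSL(2, F))) ∧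
    -- `q ^ (2 - o(1)) ≤ β(PSL₂(q))` as `q → ∞`
    (∃ ε : ℕ → ℝ, Tendsto ε atTop (𝓝 0) ∧ ∃ q₀ : ℕ,
      ∀ (F : Type u) [Field F] [Finite F], q₀ ≤ Nat.card F →
        (Nat.card F : ℝ) ^ (2 - ε (Nat.card F)) ≤ (invBeta PSL(2, F) : ℝ)) ∧
    -- `β(PSL₂(q)) ≤ q ^ 2 / 2 + O(q)`
    (∃ K : ℝ, ∀ (F : Type u) [Field F] [Finite F], 4 ≤ Nat.card F →
      (invBeta PSL(2, F) : ℝ) ≤ (Nat.card F : ℝ) ^ 2 / 2 + K * (Nat.card F : ℝ)) ∧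
    -- `N(PSL₂(q)) ≥ 2 ^ (q ^ (2 - o(1)))` as `q → ∞`
    (∃ ε : ℕ → ℝ, Tendsto ε atTop (𝓝 0) ∧ ∃ q₀ : ℕ,
      ∀ (F : Type u) [Field F] [Finite F], q₀ ≤ Nat.card F →
        (2 : ℝ) ^ ((Nat.card F : ℝ) ^ (2 - ε (Nat.card F))) ≤
          (numComponents PSL(2, F) : ℝ)) := by
  have hβ : ∀ (F : Type u) [Field F] [Finite F], 4 ≤ Nat.card F →
      invBeta PSL(2, F) = Nat.card (InvGenOrbit PSL(2, F)) := fun F _ _ hF => by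
    have := Matrix.ProjectiveSpecialLinearGroup.rank_two_simple hF
    exact invBeta_eq (SL2.exists_mul_ne_mul F)
  obtain ⟨q₀, hq₀, hlarge⟩ := rpow_le_half_sub_one
  refine ⟨fun F _ _ hF => ?_, ⟨exponentLoss, tendsto_exponentLoss, q₀, fun F _ _ hF => ?_⟩,
    -- `(q + 3)² / 2 = q²/2 + 3q + 9/2`, and `9/2 ≤ 2q` for `q ≥ 4`.
    ⟨5, fun F _ _ hF => ?_⟩, ⟨exponentLoss, tendsto_exponentLoss, q₀, fun F _ _ hF => ?_⟩⟩
  · have := Matrix.ProjectiveSpecialLinearGroup.rank_two_simple hF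
    rw [hβ F hF, invTwoGenPowers_eq (SL2.exists_mul_ne_mul F)]
    exact isGreatest_Iic
  · have h := hlarge _ _ hF (SL2.sq_le_card_invGenOrbit (hq₀.trans hF))
    rw [hβ F (by omega)]
    have : (0 : ℝ) ≤ Nat.card (InvGenOrbit PSL(2, F)) := Nat.cast_nonneg _
    linarith
  · have h : (2 : ℝ) * Nat.card (InvGenOrbit PSL(2, F)) ≤ (Nat.card F + 3) ^ 2 := by
      exact_mod_cast SL2.two_mul_card_invGenOrbit_le F
    have hq : (4 : ℝ) ≤ Nat.card F := by exact_mod_cast hF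
    rw [hβ F hF]
    nlinarith
  · have h := hlarge _ _ hF (SL2.sq_le_card_invGenOrbit (hq₀.trans hF))
    rw [SL2.card_invGenOrbit_eq] at h
    push_cast at h
    have hpos : 0 < Nat.card (SL2.NonsplitOrbit F) := by
      have h0 : (0 : ℝ) < (Nat.card F : ℝ) ^ (2 - exponentLoss (Nat.card F)) :=
        Real.rpow_pos_of_pos (by exact_mod_cast (by omega : 0 < Nat.card F)) _
      have : (0 : ℝ) < Nat.card (SL2.NonsplitOrbit F) := by linarith
      exact_mod_cast this
    have hN : (2 : ℝ) ^ Nat.card (SL2.NonsplitOrbit F) ≤ 2 * numComponents PSL(2, F) := by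
      exact_mod_cast SL2.two_pow_le_two_mul_numComponents F (by omega) hpos
    calc (2 : ℝ) ^ ((Nat.card F : ℝ) ^ (2 - exponentLoss (Nat.card F)))
        ≤ (2 : ℝ) ^ ((Nat.card (SL2.NonsplitOrbit F) : ℝ) - 1) :=
          Real.rpow_le_rpow_of_exponent_le (by norm_num) (by linarith)
      _ = 2 ^ Nat.card (SL2.NonsplitOrbit F) / 2 := by
          rw [Real.rpow_sub (by norm_num), Real.rpow_natCast, Real.rpow_one]
      _ ≤ _ := by linarith
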